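/- **Setting and conventions.** Let $m$ be a smooth real function on an open set $I\subseteq\mathbb R$, and let $M$ be an open set of points $(u,r,\theta,\phi)$ with $u\in I$, $r>0$, $0<\theta<\pi$, on which $m'(u)$ is not identically zero. Equip $M$ with the Vaidya metric $$ds^2=-\Bigl(1-\frac{2m(u)}{r}\Bigr)du^2-2\,dr\,du+r^2(d\theta^2+\sin^2\theta\,d\phi^2),$$ and let $\nabla$ be its Levi-Civita connection and $n=4$. The curvature operator is $\mathcal R(X,Y)=\nabla_{[X,Y]}-[\nabla_X,\nabla_Y]$; put $R(X_1,X_2,X_3,X_4)=g(\mathcal R(X_1,X_2)X_3,X_4)$, $S(Y,Z)=\operatorname{tr}(X\mapsto\mathcal R(X,Y)Z)$, $\kappa=\operatorname{tr}_gS$. For a symmetric $(0,2)$-tensor $A$ let $(X\wedge_AY)Z=A(Y,Z)X-A(X,Z)Y$ and let $\wedge_A$ be the $(0,4)$-tensor $g((X_1\wedge_AX_2)X_3,X_4)$; $\mathfrak G=\wedge_g$. The Kulkarni–Nomizu product is $(A\wedge E)(X_1,X_2,X_3,X_4)=A(X_1,X_4)E(X_2,X_3)+A(X_2,X_3)E(X_1,X_4)-A(X_1,X_3)E(X_2,X_4)-A(X_2,X_4)E(X_1,X_3)$.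 The projective, conharmonic, concircular and conformal curvature tensors are $P=R-\frac1{n-1}\wedge_S$, $K=R-\frac1{n-2}\,g\wedge S$, $W=R-\frac{\kappa}{n(n-1)}\mathfrak G$, $C=K+\frac{\kappa}{(n-1)(n-2)}\mathfrak G$. For a $(0,4)$-tensor $D$ write $D(X,Y,Z,V)=g(\mathcal D(X,Y)Z,V)$. For a $(0,k)$-tensor $H$ let $(D\cdot H)(X_1,\dots,X_k,X,Y)=-\sum_sH(X_1,\dots,\mathcal D(X,Y)X_s,\dots,X_k)$ and $Q(A,H)(X_1,\dots,X_k,X,Y)=\sum_s\bigl(A(X,X_s)H(\dots,Y,\dots)-A(Y,X_s)H(\dots,X,\dots)\bigr)$ ($Y$, resp. $X$, in the $s$-th place); thus $Q(g,H)=\mathfrak G\cdot H$ and $Q(S,H)=\wedge_S\cdot H$. $M$ is *Deszcz pseudosymmetric*, *Ricci generalized pseudosymmetric*, *Weyl pseudosymmetric* if at each point $R\cdot R$ and $Q(g,R)$, resp. $R\cdot R$ and $Q(S,R)$, resp. $R\cdot C$ and $Q(g,C)$, are linearly dependent; it is *conformally semisymmetric* if $R\cdot C=0$. A tensor field $T$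 is recurrent if $\nabla T=\Pi\otimes T$ for some 1-form $\Pi$. The curvature 2-forms $\Omega^m_{(D)l}=D_{jkl}{}^m\,dx^j\wedge dx^k$ are recurrent for a 1-form $\Pi$ if $\mathfrak D\Omega^m_{(D)l}=\Pi\wedge\Omega^m_{(D)l}$, where $\mathfrak D$ is the exterior covariant derivative, and recurrent if this holds for some $\Pi$ that is not identically zero; the Ricci 1-forms $\Lambda_{(S)l}=S_{lm}dx^m$ are recurrent if $\mathfrak D\Lambda_{(S)l}=\Pi\wedge\Lambda_{(S)l}$ for some $\Pi$. For a $(0,2)$-tensor $E$ let $g(\mathcal EX,Y)=E(X,Y)$. For $D\in\{R,C,K\}$, $E$ is $D$-compatible if $D(\mathcal EX_1,X,X_2,X_3)+D(\mathcal EX_2,X,X_3,X_1)+D(\mathcal EX_3,X,X_1,X_2)=0$ for all vectors; equivalently, by the symmetries of these tensors, if $D(X_2,X_3,X,\mathcal EX_1)+D(X_3,X_1,X,\mathcal EX_2)+D(X_1,X_2,X,\mathcal EX_3)=0$. For $D=P$, which lacks these symmetries, $P$-compatibility is the second equation. **Theorem.** The following hold on $M$. 1. $M$ is neither Ricci flat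 nor Ricci symmetric ($\nabla S\not\equiv0$), but $\kappa=0$, and $R=W$, $C=K$. 2. $M$ is neither conformally semisymmetric nor Deszcz pseudosymmetric, but $C\cdot C=\frac{m}{r^3}Q(g,C)$. 3. $M$ is neither Ricci generalized pseudosymmetric nor Weyl pseudosymmetric, but $R\cdot R-Q(S,R)=\frac{m}{r^3}Q(g,C)$ and $R\cdot C+C\cdot R=\frac{2m}{r^3}Q(g,C)+Q(S,C)$. 4. $C$ is not recurrent, and the Ricci 1-forms $\Lambda_{(S)l}$ are not recurrent. If $m(u)\neq0$ at every point of $M$, then the curvature 2-forms $\Omega^m_{(R)l}$ are not recurrent, but the conformal curvature 2-forms $\Omega^m_{(C)l}$ are recurrent, for the 1-form $\Pi=\left(\frac{m'}{m},0,0,0\right)$. 5. $M$ is not Einstein (there is no function $\alpha$ with $S=\alpha g$), but it is Ricci simple: $S=2m'\,\eta\otimes\eta$ with $\eta=\left(\frac1r,0,0,0\right)$ and $g(\eta,\eta)=0$. Moreover $S\wedge S=0$ and $S^2=0$, where $S^2(X,Y)=S(\mathcal SX,Y)$. 6. $S$ is neither cyclic parallel nor of Codazzi type, but it is $R$-compatible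 and $C$-compatible. 7. At each point of $M$ with $m(u)\ne0$, a (not necessarily symmetric) $(0,2)$-tensor satisfies the compatibility equation for $R$ if and only if it satisfies the one for $P$, if and only if its matrix in the coordinates $(u,r,\theta,\phi)$ has the form $$\begin{pmatrix}a_{11}&a_{12}&0&0\\a_{12}+\frac{rm'}{m}a_{22}&a_{22}&0&0\\0&0&a_{33}&a_{43}\\0&0&a_{43}&a_{44}\end{pmatrix},\qquad a_{ij}\in\mathbb R.$$ In particular, a symmetric tensor satisfies them if and only if it has this form with $m'a_{22}=0$. 8. At each point of $M$ with $m(u)\ne0$, a (not necessarily symmetric) $(0,2)$-tensor satisfies the compatibility equation for $C$ if and only if it satisfies the one for $K$, if and only if its matrix has the form $$\begin{pmatrix}a_{11}&a_{12}&0&0\\a_{12}&a_{22}&0&0\\0&0&a_{33}&a_{34}\\0&0&a_{34}&a_{44}\end{pmatrix},\qquad a_{ij}\in\mathbb R.$$ -/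

import Mathlib

open scoped ContDiff

noncomputable section

namespace Vaidya

/-- Components of a `(0,k)`-tensor at a point of an `n`-dimensional coordinate domain. -/
abbrev Tensor (n k : ℕ) := (Fin k → Fin n) → ℝ

/-- A `(0,k)`-tensor field on a coordinate domain, given by its components in the coordinate
frame. -/
abbrev TensorField (n k : ℕ) := (Fin n → ℝ) → Tensor n k

/-- A semi-Riemannian metric on a coordinate domain, given by its matrix of components. -/
abbrev Metric (n : ℕ) := (Fin n → ℝ) → Matrix (Fin n) (Fin n) ℝ

/-- The `(0,2)`-tensor with matrix `A`. -/
def ofMatrix {n : ℕ} (A : Matrix (Fin n) (Fin n) ℝ) : Tensor n 2 := fun I => A (I 0) (I 1)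

/-! ### Algebra of tensors at a point; `G` is the matrix of the metric there -/

/-- The endomorphism `𝓔` of a `(0,2)`-tensor `E`, `g(𝓔 X, Y) = E(X, Y)`:
`endo G E i p` is the `p`-th component of `𝓔 ∂_i`. -/
def endo {n : ℕ} (G : Matrix (Fin n) (Fin n) ℝ) (E : Tensor n 2) (i p : Fin n) : ℝ :=
  ∑ q, E ![i, q] * G⁻¹ q p

/-- The `(1,3)`-tensor `𝓓` of a `(0,4)`-tensor `D`, `D(X,Y,Z,V) = g(𝓓(X,Y)Z, V)`:
`raise G D i j k p` is the `p`-th component of `𝓓(∂_i, ∂_j)∂_k`. -/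
def raise {n : ℕ} (G : Matrix (Fin n) (Fin n) ℝ) (D : Tensor n 4) (i j k p : Fin n) : ℝ :=
  ∑ q, D ![i, j, k, q] * G⁻¹ q p

/-- The Kulkarni-Nomizu product `A ∧ E` of two `(0,2)`-tensors. -/
def kulkarniNomizu {n : ℕ} (A E : Tensor n 2) : Tensor n 4 := fun I =>
  A ![I 0, I 3] * E ![I 1, I 2] + A ![I 1, I 2] * E ![I 0, I 3]
    - A ![I 0, I 2] * E ![I 1, I 3] - A ![I 1, I 3] * E ![I 0, I 2]

/-- The `(0,4)`-tensor `∧_A`, `(X₁,X₂,X₃,X₄) ↦ g((X₁ ∧_A X₂) X₃, X₄)`, where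
`(X ∧_A Y) Z = A(Y,Z) X - A(X,Z) Y`. -/
def wedgeTensor {n : ℕ} (G : Matrix (Fin n) (Fin n) ℝ) (A : Tensor n 2) : Tensor n 4 := fun I =>
  A ![I 1, I 2] * G (I 0) (I 3) - A ![I 0, I 2] * G (I 1) (I 3)

/-- The `(0,k+2)`-tensor `D · H`:
`(D·H)(X₁,…,X_k,X,Y) = - ∑ₛ H(X₁,…,𝓓(X,Y)Xₛ,…,X_k)`.
The arguments are `X₁,…,X_k`, then `X`, then `Y`. -/
def dot {n k : ℕ} (G : Matrix (Fin n) (Fin n) ℝ) (D : Tensor n 4) (H : Tensor n k) :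
    (Fin k → Fin n) → Fin n → Fin n → ℝ := fun I a b =>
  -∑ s, ∑ p, raise G D a b (I s) p * H (Function.update I s p)

/-- The `(0,k+2)`-tensor `Q(A,H)`:
`Q(A,H)(X₁,…,X_k,X,Y) = ∑ₛ (A(X,Xₛ) H(X₁,…,Y,…,X_k) - A(Y,Xₛ) H(X₁,…,X,…,X_k))`,
with `Y` resp. `X` in the place of `Xₛ`. -/
def tachibana {n k : ℕ} (A : Tensor n 2) (H : Tensor n k) :
    (Fin k → Fin n) → Fin n → Fin n → ℝ := fun I a b =>
  ∑ s, (A ![a, I s] * H (Function.update I s b) - A ![b, I s] * H (Function.update I s a))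

/-- `E` is `D`-compatible:
`D(𝓔X₁,X,X₂,X₃) + D(𝓔X₂,X,X₃,X₁) + D(𝓔X₃,X,X₁,X₂) = 0` for all vectors. -/
def IsCompatible {n : ℕ} (G : Matrix (Fin n) (Fin n) ℝ) (D : Tensor n 4) (E : Tensor n 2) : Prop :=
  ∀ i j k l, ∑ p, (endo G E i p * D ![p, j, k, l] + endo G E k p * D ![p, j, l, i]
    + endo G E l p * D ![p, j, i, k]) = 0

/-- `D`-compatibility with the endomorphism in the last argument, that is,
`E_{im} D_{klj}^m + E_{km} D_{lij}^m + E_{lm} D_{ikj}^m = 0`, or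
`D(X₂,X₃,X,𝓔X₁) + D(X₃,X₁,X,𝓔X₂) + D(X₁,X₂,X,𝓔X₃) = 0` for all vectors.
It agrees with `IsCompatible` when `D` has the symmetries of a Riemann tensor, and is the one
that makes sense of compatibility with the projective tensor, which lacks them. -/
def IsCompatibleLast {n : ℕ} (G : Matrix (Fin n) (Fin n) ℝ) (D : Tensor n 4) (E : Tensor n 2) :
    Prop :=
  ∀ i j k l, ∑ p, (endo G E i p * D ![k, l, j, p] + endo G E k p * D ![l, i, j, p]
    + endo G E l p * D ![i, k, j, p]) = 0

/-- For a `(0,4)`-tensor with the symmetries of a Riemann tensor both forms of compatibility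
coincide. -/
theorem isCompatible_iff_last {n : ℕ} (G : Matrix (Fin n) (Fin n) ℝ) (D : Tensor n 4)
    (E : Tensor n 2) (h1 : ∀ i j k l, D ![i, j, k, l] = -D ![j, i, k, l])
    (h2 : ∀ i j k l, D ![i, j, k, l] = D ![k, l, i, j]) :
    IsCompatible G D E ↔ IsCompatibleLast G D E := by
  have h : ∀ p j k l, D ![p, j, k, l] = -D ![k, l, j, p] := fun p j k l => by
    rw [h1, h2]
  unfold IsCompatible IsCompatibleLast
  refine forall_congr' fun i => forall_congr' fun j => forall_congr' fun k => forall_congr' fun l => ?_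
  rw [← neg_eq_zero, ← Finset.sum_neg_distrib]
  refine Eq.congr (Finset.sum_congr rfl fun p _ => ?_) rfl
  rw [h p j k l, h p j l i, h p j i k]
  ring

/-! ### Calculus on a coordinate domain -/

/-- The partial derivative `∂_i f`. -/
def pd {n : ℕ} (i : Fin n) (f : (Fin n → ℝ) → ℝ) (x : Fin n → ℝ) : ℝ :=
  deriv (fun t => f (Function.update x i t)) (x i)

/-- The Christoffel symbols of the Levi-Civita connection:
`∇_{∂_i} ∂_j = ∑ₚ (christoffel g x p i j) ∂_p`. -/
def christoffel {n : ℕ} (g : Metric n) (x : Fin n → ℝ) (p i j : Fin n) : ℝ :=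
  1 / 2 * ∑ l, (g x)⁻¹ p l *
    (pd i (fun y => g y j l) x + pd j (fun y => g y i l) x - pd l (fun y => g y i j) x)

/-- The covariant derivative of a `(0,k)`-tensor field; `covDeriv g T x a I` is
`(∇_{∂_a} T)(∂_{I 0}, …, ∂_{I (k-1)})` at `x`. -/
def covDeriv {n k : ℕ} (g : Metric n) (T : TensorField n k) (x : Fin n → ℝ) (a : Fin n) :
    Tensor n k := fun I =>
  pd a (fun y => T y I) x - ∑ s, ∑ p, christoffel g x p a (I s) * T x (Function.update I s p)

/-- The curvature operator in the sign convention `𝓡(X,Y) = ∇_{[X,Y]} - [∇_X, ∇_Y]`: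
`curvOp g x i j k p` is the `p`-th component of `𝓡(∂_i, ∂_j)∂_k`. -/
def curvOp {n : ℕ} (g : Metric n) (x : Fin n → ℝ) (i j k p : Fin n) : ℝ :=
  pd j (fun y => christoffel g y p i k) x - pd i (fun y => christoffel g y p j k) x
    + ∑ q, (christoffel g x q i k * christoffel g x p j q
      - christoffel g x q j k * christoffel g x p i q)

/-- The metric as a `(0,2)`-tensor field. -/
def metric {n : ℕ} (g : Metric n) : TensorField n 2 := fun x => ofMatrix (g x)

/-- The Riemann-Christoffel tensor `R(X₁,X₂,X₃,X₄) = g(𝓡(X₁,X₂)X₃, X₄)`. -/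
def riemann {n : ℕ} (g : Metric n) : TensorField n 4 := fun x I =>
  ∑ p, curvOp g x (I 0) (I 1) (I 2) p * g x p (I 3)

/-- The Ricci tensor `S(Y,Z) = tr (X ↦ 𝓡(X,Y)Z)`. -/
def ricci {n : ℕ} (g : Metric n) : TensorField n 2 := fun x I =>
  ∑ p, curvOp g x p (I 0) (I 1) p

/-- The scalar curvature, the trace of the Ricci tensor. -/
def scalarCurv {n : ℕ} (g : Metric n) (x : Fin n → ℝ) : ℝ :=
  ∑ i, ∑ j, (g x)⁻¹ i j * ricci g x ![i, j]

/-- The Gaussian curvature tensor `𝔊 = ∧_g`. -/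
def gaussian {n : ℕ} (g : Metric n) : TensorField n 4 := fun x =>
  wedgeTensor (g x) (metric g x)

/-- The projective curvature tensor `P = R - (1/(n-1)) ∧_S`. -/
def projective {n : ℕ} (g : Metric n) : TensorField n 4 := fun x =>
  riemann g x - (1 / ((n : ℝ) - 1)) • wedgeTensor (g x) (ricci g x)

/-- The conharmonic curvature tensor `K = R - (1/(n-2)) g ∧ S`. -/
def conharmonic {n : ℕ} (g : Metric n) : TensorField n 4 := fun x =>
  riemann g x - (1 / ((n : ℝ) - 2)) • kulkarniNomizu (metric g x) (ricci g x)

/-- The concircular curvature tensor `W = R - (κ/(n(n-1))) 𝔊`. -/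
def concircular {n : ℕ} (g : Metric n) : TensorField n 4 := fun x =>
  riemann g x - (scalarCurv g x / ((n : ℝ) * ((n : ℝ) - 1))) • gaussian g x

/-- The conformal (Weyl) curvature tensor `C = K + (κ/((n-2)(n-1))) 𝔊`. -/
def weyl {n : ℕ} (g : Metric n) : TensorField n 4 := fun x =>
  conharmonic g x + (scalarCurv g x / (((n : ℝ) - 2) * ((n : ℝ) - 1))) • gaussian g x

/-- The tensor `S²`, `S²(X,Y) = S(𝓢X, Y)`. -/
def ricciSq {n : ℕ} (g : Metric n) : TensorField n 2 := fun x I =>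
  ∑ p, endo (g x) (ricci g x) (I 0) p * ricci g x ![p, I 1]

/-- `g(η,η)` for a covector `η` at `x`. -/
def covectorSq {n : ℕ} (g : Metric n) (x : Fin n → ℝ) (η : Fin n → ℝ) : ℝ :=
  ∑ i, ∑ j, (g x)⁻¹ i j * η i * η j

/-! ### Curvature restricted structures on a set `U` of points -/

/-- The pseudosymmetric type condition `(c₁ D₁ + c₂ D₂) · H = 0` on `U`, with scalars `c₁, c₂`
that do not vanish simultaneously. -/
def PseudosymmetricType {n k : ℕ} (g : Metric n) (U : Set (Fin n → ℝ))
    (D₁ D₂ : TensorField n 4) (H : TensorField n k) : Prop :=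
  ∃ c₁ c₂ : (Fin n → ℝ) → ℝ, ∀ x ∈ U, (c₁ x ≠ 0 ∨ c₂ x ≠ 0) ∧
    dot (g x) (c₁ x • D₁ x + c₂ x • D₂ x) (H x) = 0

/-- Deszcz pseudosymmetry: `R · R` and `Q(g,R) = 𝔊 · R` are linearly dependent at each point. -/
def DeszczPseudosymmetric {n : ℕ} (g : Metric n) (U : Set (Fin n → ℝ)) : Prop :=
  PseudosymmetricType g U (riemann g) (gaussian g) (riemann g)

/-- Ricci generalized pseudosymmetry: `R · R` and `Q(S,R) = ∧_S · R` are linearly dependent at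
each point. -/
def RicciGeneralizedPseudosymmetric {n : ℕ} (g : Metric n) (U : Set (Fin n → ℝ)) : Prop :=
  PseudosymmetricType g U (riemann g) (fun x => wedgeTensor (g x) (ricci g x)) (riemann g)

/-- Weyl pseudosymmetry: `R · C` and `Q(g,C) = 𝔊 · C` are linearly dependent at each point. -/
def WeylPseudosymmetric {n : ℕ} (g : Metric n) (U : Set (Fin n → ℝ)) : Prop :=
  PseudosymmetricType g U (riemann g) (gaussian g) (weyl g)

/-- `∇D = Π ⊗ D` on `U` for the 1-form `Π`. -/
def RecurrentWith {n k : ℕ} (g : Metric n) (U : Set (Fin n → ℝ)) (D : TensorField n k)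
    (Pi : (Fin n → ℝ) → Fin n → ℝ) : Prop :=
  ∀ x ∈ U, ∀ a I, covDeriv g D x a I = Pi x a * D x I

/-- The curvature 2-forms `Ω_l^m = D_{jkl}^m dx^j ∧ dx^k`, up to the common factor `2`:
`curvForm g D l m x j k` is the coefficient `D_{jkl}^m`. -/
def curvForm {n : ℕ} (g : Metric n) (D : TensorField n 4) (l m : Fin n) (x : Fin n → ℝ)
    (j k : Fin n) : ℝ :=
  raise (g x) (D x) j k l m

/-- `(∂_i Ω)^m_l + Γ^m_{ip} Ω^p_l - Γ^p_{il} Ω^m_p` for an endomorphism valued 2-form `Ω`,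
on the coordinate vectors `∂_j, ∂_k`. -/
def frameDeriv {n : ℕ} (g : Metric n) (Ω : Fin n → Fin n → (Fin n → ℝ) → Fin n → Fin n → ℝ)
    (l m : Fin n) (x : Fin n → ℝ) (i j k : Fin n) : ℝ :=
  pd i (fun y => Ω l m y j k) x + ∑ p, (christoffel g x m i p * Ω l p x j k
    - christoffel g x p i l * Ω p m x j k)

/-- The exterior covariant derivative `𝔇Ω^m_l = dΩ^m_l + Γ^m_p ∧ Ω^p_l - Γ^p_l ∧ Ω^m_p`, with the
connection forms `Γ^m_p = Γ^m_{ip} dx^i`, evaluated at `(∂_i, ∂_j, ∂_k)`. -/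
def extCovDeriv {n : ℕ} (g : Metric n) (Ω : Fin n → Fin n → (Fin n → ℝ) → Fin n → Fin n → ℝ)
    (l m : Fin n) (x : Fin n → ℝ) (i j k : Fin n) : ℝ :=
  frameDeriv g Ω l m x i j k + frameDeriv g Ω l m x j k i + frameDeriv g Ω l m x k i j

/-- `𝔇Ω_l^m = Π ∧ Ω_l^m` on `U` for the curvature 2-forms `Ω` of `D` and the 1-form `Π`. -/
def CurvFormsRecurrentWith {n : ℕ} (g : Metric n) (U : Set (Fin n → ℝ)) (D : TensorField n 4)
    (Pi : (Fin n → ℝ) → Fin n → ℝ) : Prop :=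
  ∀ x ∈ U, ∀ l m i j k, extCovDeriv g (curvForm g D) l m x i j k =
    Pi x i * curvForm g D l m x j k + Pi x j * curvForm g D l m x k i
      + Pi x k * curvForm g D l m x i j

/-- The curvature 2-forms of `D` are recurrent on `U`: the recurrence equation holds for a 1-form
`Π` which is not identically zero. (For `Π = 0` it only says that the forms are closed, which for
`D = R` is the second Bianchi identity.) -/
def CurvFormsRecurrent {n : ℕ} (g : Metric n) (U : Set (Fin n → ℝ)) (D : TensorField n 4) : Prop :=
  ∃ Pi : (Fin n → ℝ) → Fin n → ℝ, (∃ x ∈ U, Pi x ≠ 0) ∧ CurvFormsRecurrentWith g U D Pi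

/-- `∂_i Z_{lj} - Γ^p_{il} Z_{pj}`, a summand of the exterior covariant derivative of the 1-forms
`Λ_l = Z_{lj} dx^j`. -/
def frameDerivOne {n : ℕ} (g : Metric n) (Z : TensorField n 2) (l : Fin n) (x : Fin n → ℝ)
    (i j : Fin n) : ℝ :=
  pd i (fun y => Z y ![l, j]) x - ∑ p, christoffel g x p i l * Z x ![p, j]

/-- `𝔇Λ_l = Π ∧ Λ_l` on `U` for the 1-forms `Λ_l = Z_{lj} dx^j` and the 1-form `Π`, where
`𝔇Λ_l = dΛ_l - Γ^p_l ∧ Λ_p`. -/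
def OneFormsRecurrentWith {n : ℕ} (g : Metric n) (U : Set (Fin n → ℝ)) (Z : TensorField n 2)
    (Pi : (Fin n → ℝ) → Fin n → ℝ) : Prop :=
  ∀ x ∈ U, ∀ l i j, frameDerivOne g Z l x i j - frameDerivOne g Z l x j i =
    Pi x i * Z x ![l, j] - Pi x j * Z x ![l, i]

/-- `Z` is a Codazzi tensor on `U`: `(∇_X Z)(Y,V) = (∇_Y Z)(X,V)`. -/
def IsCodazzi {n : ℕ} (g : Metric n) (U : Set (Fin n → ℝ)) (Z : TensorField n 2) : Prop :=
  ∀ x ∈ U, ∀ i j k, covDeriv g Z x i ![j, k] = covDeriv g Z x j ![i, k]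

/-- `Z` is cyclic parallel on `U`: `(∇_X Z)(Y,V) + (∇_Y Z)(V,X) + (∇_V Z)(X,Y) = 0`. -/
def IsCyclicParallel {n : ℕ} (g : Metric n) (U : Set (Fin n → ℝ)) (Z : TensorField n 2) : Prop :=
  ∀ x ∈ U, ∀ i j k,
    covDeriv g Z x i ![j, k] + covDeriv g Z x j ![k, i] + covDeriv g Z x k ![i, j] = 0

/-! ### The Vaidya metric -/

/-- The Vaidya metric with mass function `m`, in the coordinates
`x = (u, r, θ, φ) = (x 0, x 1, x 2, x 3)`:
`ds² = -(1 - 2m(u)/r) du² - 2 dr du + r² (dθ² + sin²θ dφ²)`. -/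
def vaidya (m : ℝ → ℝ) : Metric 4 := fun x =>
  !![-(1 - 2 * m (x 0) / x 1), -1, 0, 0;
     -1, 0, 0, 0;
     0, 0, x 1 ^ 2, 0;
     0, 0, 0, x 1 ^ 2 * Real.sin (x 2) ^ 2]

/-- The 1-form `η = (1/r, 0, 0, 0)`. -/
def eta (x : Fin 4 → ℝ) : Fin 4 → ℝ := ![1 / x 1, 0, 0, 0]

end Vaidya

end

/-!
The Vaidya metric splits orthogonally as `g = h + s`, with `h` its restriction to the
`(u, r)`-plane and `s` its restriction to the spheres. A computation with the Christoffel symbols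
(`curvOp_vaidya`) shows that its curvature tensor is `R = C + ½ g ∧ S`, where

* `C = -(m/r³) (h ∧ h - h ∧ s + s ∧ s)` is trace-free, hence the Weyl tensor, and
* `S = (2m'/r²) du ⊗ du` is the Ricci tensor; since `du` is null, the scalar curvature vanishes.

Everything else is read off from this decomposition. The tensors `D · H` and `Q(A, H)` are values
of derivations of the tensor algebra (`derivation`), and derivations obey the Leibniz rule for the
Kulkarni-Nomizu product (`derivation_kulkarniNomizu`). So the pseudosymmetry identities reduce to
the action of `C`, `½ g ∧ S`, `g` and `S` on the three symmetric tensors `h`, `s` and `du ⊗ du`.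
There `C · h = (m/r³) Q(g, h)` and the same for `s`, which gives `C · C = (m/r³) Q(g, C)`
(`derivation_weylMixed_weylTensor`), and the mixed terms satisfy
`(½ g ∧ S) · C + C · (½ g ∧ S) = Q(S, C)` (`derivation_mixed_terms`), because `h` is itself
a symmetric product with `du` and such products are annihilated by `du ⊗ du` under the
Kulkarni-Nomizu product
(`kulkarniNomizu_symProd_self`).

The negative statements are checked on single components at a point where `m ≠ 0` and `m' ≠ 0`;
such a point exists, as a zero of `m` with `m' ≠ 0` is isolated (`exists_mass_ne_zero`). The
recurrence equation of the curvature 2-forms of `C` is alternating in its three arguments, so it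
is enough to compute it on increasing triples (`curvFormsRecurrentWith_weyl`). The forms of `R`
are closed by the second Bianchi identity; hence `Π ∧ Ω = 0`, which forces `Π = 0`. Finally the
compatibility equation is an alternating linear system for the matrix entries. It is solved at
once for the tensors `C + ½ g ∧ S + t ∧_S` (`compatible_curvatureFamily_iff`), a family that
contains `R`, `P` and, for `S = 0`, also `C`.
-/

noncomputable section

namespace Vaidya

/-! ### Tensor algebra at a point -/

theorem update_vec_two_zero {n : ℕ} (i j p : Fin n) :
    Function.update ![i, j] 0 p = ![p, j] := by
  ext s; fin_cases s <;> rfl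

theorem update_vec_two_one {n : ℕ} (i j p : Fin n) :
    Function.update ![i, j] 1 p = ![i, p] := by
  ext s; fin_cases s <;> rfl

theorem update_vec_four_zero {n : ℕ} (i j k l p : Fin n) :
    Function.update ![i, j, k, l] 0 p = ![p, j, k, l] := by
  ext s; fin_cases s <;> rfl

theorem update_vec_four_one {n : ℕ} (i j k l p : Fin n) :
    Function.update ![i, j, k, l] 1 p = ![i, p, k, l] := by
  ext s; fin_cases s <;> rfl

theorem update_vec_four_two {n : ℕ} (i j k l p : Fin n) :
    Function.update ![i, j, k, l] 2 p = ![i, j, p, l] := by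
  ext s; fin_cases s <;> rfl

theorem update_vec_four_three {n : ℕ} (i j k l p : Fin n) :
    Function.update ![i, j, k, l] 3 p = ![i, j, k, p] := by
  ext s; fin_cases s <;> rfl

theorem Tensor.ext_two {n : ℕ} {A B : Tensor n 2} (h : ∀ i j, A ![i, j] = B ![i, j]) : A = B := by
  ext J
  have : J = ![J 0, J 1] := by ext s; fin_cases s <;> rfl
  rw [this, h]

theorem Tensor.ext_four {n : ℕ} {A B : Tensor n 4}
    (h : ∀ i j k l, A ![i, j, k, l] = B ![i, j, k, l]) : A = B := by
  ext J
  have : J = ![J 0, J 1, J 2, J 3] := by ext s; fin_cases s <;> rfl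
  rw [this, h]

@[simp] theorem ofMatrix_apply {n : ℕ} (A : Matrix (Fin n) (Fin n) ℝ) (i j : Fin n) :
    ofMatrix A ![i, j] = A i j := rfl

@[simp] theorem kulkarniNomizu_apply {n : ℕ} (A E : Tensor n 2) (i j k l : Fin n) :
    kulkarniNomizu A E ![i, j, k, l] = A ![i, l] * E ![j, k] + A ![j, k] * E ![i, l]
      - A ![i, k] * E ![j, l] - A ![j, l] * E ![i, k] := rfl

@[simp] theorem wedgeTensor_apply {n : ℕ} (G : Matrix (Fin n) (Fin n) ℝ) (A : Tensor n 2)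
    (i j k l : Fin n) :
    wedgeTensor G A ![i, j, k, l] = A ![j, k] * G i l - A ![i, k] * G j l := rfl

/-- The derivation of the algebra of covariant tensors that extends the transpose of the
endomorphism `L`, where `L i p` is the `p`-th component of `L ∂_i`:
`(L·H)(X₁,…,X_k) = ∑ₛ H(X₁,…,L Xₛ,…,X_k)`. -/
def derivation {n k : ℕ} (L : Fin n → Fin n → ℝ) (H : Tensor n k) : Tensor n k := fun I =>
  ∑ s, ∑ p, L (I s) p * H (Function.update I s p)

theorem derivation_add {n k : ℕ} (L : Fin n → Fin n → ℝ) (H H' : Tensor n k) :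
    derivation L (H + H') = derivation L H + derivation L H' := by
  ext I
  simp only [derivation, Pi.add_apply, mul_add, Finset.sum_add_distrib]

theorem derivation_smul {n k : ℕ} (L : Fin n → Fin n → ℝ) (c : ℝ) (H : Tensor n k) :
    derivation L (c • H) = c • derivation L H := by
  ext I
  simp only [derivation, Pi.smul_apply, smul_eq_mul, Finset.mul_sum]
  exact Finset.sum_congr rfl fun s _ => Finset.sum_congr rfl fun p _ => by ring

theorem derivation_sub {n k : ℕ} (L : Fin n → Fin n → ℝ) (H H' : Tensor n k) :
    derivation L (H - H') = derivation L H - derivation L H' := by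
  ext I
  simp only [derivation, Pi.sub_apply, mul_sub, Finset.sum_sub_distrib]

theorem add_derivation {n k : ℕ} (L L' : Fin n → Fin n → ℝ) (H : Tensor n k) :
    derivation (L + L') H = derivation L H + derivation L' H := by
  ext I
  simp only [derivation, Pi.add_apply, add_mul, Finset.sum_add_distrib]

theorem smul_derivation {n k : ℕ} (c : ℝ) (L : Fin n → Fin n → ℝ) (H : Tensor n k) :
    derivation (c • L) H = c • derivation L H := by
  ext I
  simp only [derivation, Pi.smul_apply, smul_eq_mul, Finset.mul_sum, mul_assoc]

theorem derivation_two {n : ℕ} (L : Fin n → Fin n → ℝ) (A : Tensor n 2) (i j : Fin n) :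
    derivation L A ![i, j] = ∑ p, (L i p * A ![p, j] + L j p * A ![i, p]) := by
  simp [derivation, Fin.sum_univ_two, update_vec_two_zero, update_vec_two_one,
    Finset.sum_add_distrib]

/-- A derivation satisfies the Leibniz rule for the Kulkarni-Nomizu product. -/
theorem derivation_kulkarniNomizu {n : ℕ} (L : Fin n → Fin n → ℝ) (A E : Tensor n 2) :
    derivation L (kulkarniNomizu A E) =
      kulkarniNomizu (derivation L A) E + kulkarniNomizu A (derivation L E) := by
  apply Tensor.ext_four
  intro i j k l
  simp only [Pi.add_apply, kulkarniNomizu_apply, derivation_two]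
  simp only [derivation, Fin.sum_univ_four]
  simp only [← Finset.sum_add_distrib, Finset.sum_mul, Finset.mul_sum, ← Finset.sum_sub_distrib]
  refine Finset.sum_congr rfl fun p _ => ?_
  simp only [update_vec_four_zero, update_vec_four_one, update_vec_four_two,
    update_vec_four_three, kulkarniNomizu_apply, Matrix.cons_val]
  ring

theorem smul_kulkarniNomizu {n : ℕ} (c : ℝ) (A E : Tensor n 2) :
    kulkarniNomizu (c • A) E = c • kulkarniNomizu A E := by
  ext I; simp only [kulkarniNomizu, Pi.smul_apply, smul_eq_mul]; ring

theorem kulkarniNomizu_smul {n : ℕ} (c : ℝ) (A E : Tensor n 2) :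
    kulkarniNomizu A (c • E) = c • kulkarniNomizu A E := by
  ext I; simp only [kulkarniNomizu, Pi.smul_apply, smul_eq_mul]; ring

/-- The symmetric product `ξ ⊗ τ + τ ⊗ ξ` of two covectors. -/
def symProd {n : ℕ} (ξ τ : Fin n → ℝ) : Tensor n 2 := fun I =>
  ξ (I 0) * τ (I 1) + τ (I 0) * ξ (I 1)

@[simp] theorem symProd_apply {n : ℕ} (ξ τ : Fin n → ℝ) (i j : Fin n) :
    symProd ξ τ ![i, j] = ξ i * τ j + τ i * ξ j := rfl

/-- A symmetric product with the factor `ξ` is annihilated by the rank one tensor `ξ ⊗ ξ`. -/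
theorem kulkarniNomizu_symProd_self {n : ℕ} (ξ τ : Fin n → ℝ) :
    kulkarniNomizu (symProd ξ τ) (symProd ξ ξ) = 0 := by
  ext I; simp only [kulkarniNomizu, symProd_apply, Pi.zero_apply]; ring

theorem dot_eq_derivation {n k : ℕ} (G : Matrix (Fin n) (Fin n) ℝ) (D : Tensor n 4)
    (H : Tensor n k) (I : Fin k → Fin n) (a b : Fin n) :
    dot G D H I a b = -derivation (raise G D a b) H I := rfl

/-- The endomorphism `X ∧_A Y` with `X = ∂_b`, `Y = ∂_a`, through which `Q(A, ·)` acts. -/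
def wedgeEndo {n : ℕ} (A : Tensor n 2) (a b i p : Fin n) : ℝ :=
  A ![a, i] * (1 : Matrix (Fin n) (Fin n) ℝ) b p - A ![b, i] * (1 : Matrix (Fin n) (Fin n) ℝ) a p

theorem tachibana_eq_derivation {n k : ℕ} (A : Tensor n 2) (H : Tensor n k)
    (I : Fin k → Fin n) (a b : Fin n) :
    tachibana A H I a b = derivation (wedgeEndo A a b) H I := by
  simp [tachibana, derivation, wedgeEndo, Matrix.one_apply, sub_mul, Finset.sum_sub_distrib]

theorem raise_add {n : ℕ} (G : Matrix (Fin n) (Fin n) ℝ) (D D' : Tensor n 4) :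
    raise G (D + D') = raise G D + raise G D' := by
  ext i j k p
  simp [raise, add_mul, Finset.sum_add_distrib]

theorem raise_sub {n : ℕ} (G : Matrix (Fin n) (Fin n) ℝ) (D D' : Tensor n 4) :
    raise G (D - D') = raise G D - raise G D' := by
  ext i j k p
  simp [raise, sub_mul, Finset.sum_sub_distrib]

theorem raise_smul {n : ℕ} (G : Matrix (Fin n) (Fin n) ℝ) (c : ℝ) (D : Tensor n 4) :
    raise G (c • D) = c • raise G D := by
  ext i j k p
  simp [raise, Finset.mul_sum, mul_assoc]

/-- Raising the last index of `∧_A` gives the endomorphism `X ∧_A Y`. -/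
theorem raise_wedgeTensor {n : ℕ} (G : Matrix (Fin n) (Fin n) ℝ) (hG : IsUnit G.det)
    (A : Tensor n 2) (i j : Fin n) : raise G (wedgeTensor G A) i j = -wedgeEndo A i j := by
  ext k p
  have h : ∀ a b, ∑ q, G a q * G⁻¹ q b = (1 : Matrix (Fin n) (Fin n) ℝ) a b := fun a b => by
    rw [← Matrix.mul_nonsing_inv G hG, Matrix.mul_apply]
  simp only [raise, wedgeTensor_apply, sub_mul, Finset.sum_sub_distrib, mul_assoc,
    ← Finset.mul_sum, h, Pi.neg_apply, wedgeEndo]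
  ring

theorem dot_wedgeTensor {n k : ℕ} (G : Matrix (Fin n) (Fin n) ℝ) (hG : IsUnit G.det)
    (A : Tensor n 2) (H : Tensor n k) : dot G (wedgeTensor G A) H = tachibana A H := by
  ext I a b
  rw [dot_eq_derivation, tachibana_eq_derivation, raise_wedgeTensor G hG,
    ← neg_one_smul ℝ (wedgeEndo A a b), smul_derivation]
  simp

theorem dot_add {n k : ℕ} (G : Matrix (Fin n) (Fin n) ℝ) (D D' : Tensor n 4) (H : Tensor n k) :
    dot G (D + D') H = dot G D H + dot G D' H := by
  ext I a b
  simp only [dot_eq_derivation, raise_add, Pi.add_apply, add_derivation]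
  ring

theorem dot_smul {n k : ℕ} (G : Matrix (Fin n) (Fin n) ℝ) (c : ℝ) (D : Tensor n 4)
    (H : Tensor n k) : dot G (c • D) H = c • dot G D H := by
  ext I a b
  simp only [dot_eq_derivation, raise_smul, Pi.smul_apply, smul_derivation, smul_eq_mul]
  ring

/-- Lowering an index and raising it again. -/
theorem raise_lower {n : ℕ} (G : Matrix (Fin n) (Fin n) ℝ) (hG : IsUnit G.det)
    (B : Fin n → Fin n → Fin n → Fin n → ℝ) :
    raise G (fun I => ∑ p, B (I 0) (I 1) (I 2) p * G p (I 3)) = B := by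
  ext i j k p
  have h : ∀ a b, ∑ q, G a q * G⁻¹ q b = (1 : Matrix (Fin n) (Fin n) ℝ) a b := fun a b => by
    rw [← Matrix.mul_nonsing_inv G hG, Matrix.mul_apply]
  simp only [raise, Matrix.cons_val, Finset.sum_mul]
  rw [Finset.sum_comm]
  simp only [mul_assoc, ← Finset.mul_sum, h]
  simp [Matrix.one_apply]

theorem isCompatibleLast_iff_raise {n : ℕ} (G : Matrix (Fin n) (Fin n) ℝ) (hG : G.IsSymm)
    (D : Tensor n 4) (E : Tensor n 2) :
    IsCompatibleLast G D E ↔ ∀ i j k l, ∑ q, (E ![i, q] * raise G D k l j q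
      + E ![k, q] * raise G D l i j q + E ![l, q] * raise G D i k j q) = 0 := by
  have hs : ∀ p q, G⁻¹ p q = G⁻¹ q p := fun p q => hG.inv.apply q p
  have h : ∀ i a b c, ∑ p, endo G E i p * D ![a, b, c, p] = ∑ q, E ![i, q] * raise G D a b c q := by
    intro i a b c
    simp only [endo, raise, Finset.sum_mul, Finset.mul_sum]
    rw [Finset.sum_comm]
    refine Finset.sum_congr rfl fun q _ => Finset.sum_congr rfl fun p _ => ?_
    rw [hs q p]; ring
  simp only [IsCompatibleLast, Finset.sum_add_distrib, h]

/-- The compatibility and the recurrence equations are alternating in three arguments, so that it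
suffices to test them on increasing triples. -/
theorem alternating_fin_four {F : Fin 4 → Fin 4 → Fin 4 → ℝ}
    (hc : ∀ i k l, F i k l = F k l i) (ha : ∀ i k l, F i l k = -F i k l)
    (h1 : F 0 1 2 = 0) (h2 : F 0 1 3 = 0) (h3 : F 0 2 3 = 0) (h4 : F 1 2 3 = 0) (i k l : Fin 4) :
    F i k l = 0 := by
  have e : ∀ i k, F i k k = 0 := fun i k => by linarith [ha i k k]
  have e' : ∀ i k, F i i k = 0 := fun i k => by rw [hc, hc, e]
  have e'' : ∀ i k, F i k i = 0 := fun i k => by rw [hc, e]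
  have s : ∀ i k l, F i k l = 0 → F i l k = 0 ∧ F k l i = 0 ∧ F l i k = 0 ∧ F k i l = 0 ∧
      F l k i = 0 := by
    intro i k l h
    have h' : F i l k = 0 := by rw [ha, h, neg_zero]
    exact ⟨h', by rw [← hc, h], by rw [hc, h], by rw [hc, h'], by rw [← hc, h']⟩
  obtain ⟨a1, a2, a3, a4, a5⟩ := s _ _ _ h1
  obtain ⟨b1, b2, b3, b4, b5⟩ := s _ _ _ h2
  obtain ⟨c1, c2, c3, c4, c5⟩ := s _ _ _ h3
  obtain ⟨d1, d2, d3, d4, d5⟩ := s _ _ _ h4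
  fin_cases i <;> fin_cases k <;> fin_cases l <;>
    first | exact e _ _ | exact e' _ _ | exact e'' _ _ | assumption

/-! ### Partial derivatives -/

theorem eventually_update_mem {n : ℕ} {U : Set (Fin n → ℝ)} (hU : IsOpen U) {x : Fin n → ℝ}
    (hx : x ∈ U) (i : Fin n) : ∀ᶠ t in nhds (x i), Function.update x i t ∈ U := by
  have hc : Continuous (fun t : ℝ => Function.update x i t) :=
    continuous_const.update i continuous_id
  refine hc.continuousAt.eventually_mem (hU.mem_nhds ?_)
  rwa [Function.update_eq_self]

theorem pd_congr {n : ℕ} {U : Set (Fin n → ℝ)} (hU : IsOpen U) {x : Fin n → ℝ} (hx : x ∈ U)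
    {f f' : (Fin n → ℝ) → ℝ} (h : ∀ y ∈ U, f y = f' y) (i : Fin n) : pd i f x = pd i f' x := by
  refine Filter.EventuallyEq.deriv_eq ?_
  filter_upwards [eventually_update_mem hU hx i] with t ht using h _ ht

theorem pd_const {n : ℕ} (c : ℝ) (x : Fin n → ℝ) (i : Fin n) : pd i (fun _ => c) x = 0 := by
  simp [pd]

theorem hasDerivAt_coord {n : ℕ} (x : Fin n → ℝ) (i k : Fin n) :
    HasDerivAt (fun t => Function.update x i t k) (if i = k then 1 else 0) (x i) := by
  have h := hasDerivAt_pi.1 (hasDerivAt_update x i (x i)) k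
  simpa [Pi.single_apply, eq_comm] using h

theorem hasDerivAt_comp_coord {n : ℕ} {f : ℝ → ℝ} {x : Fin n → ℝ} {k : Fin n}
    (hf : DifferentiableAt ℝ f (x k)) (i : Fin n) :
    HasDerivAt (fun t => f (Function.update x i t k))
      (deriv f (x k) * if i = k then 1 else 0) (x i) := by
  refine HasDerivAt.comp (x i) (h₂ := f) ?_ (hasDerivAt_coord x i k)
  rw [Function.update_eq_self]
  exact hf.hasDerivAt

/-! ### The metric, its inverse and the Christoffel symbols -/

/-- The part of the Vaidya metric in the `(u, r)`-plane, as a function of the mass `a` and of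
the radius `r`. -/
def radial (a r : ℝ) : Matrix (Fin 4) (Fin 4) ℝ :=
  !![-(1 - 2 * a / r), -1, 0, 0; -1, 0, 0, 0; 0, 0, 0, 0; 0, 0, 0, 0]

/-- The part of the Vaidya metric tangent to the spheres, as a function of the radius `r` and of
`s = sin θ`. -/
def spherical (r s : ℝ) : Matrix (Fin 4) (Fin 4) ℝ :=
  !![0, 0, 0, 0; 0, 0, 0, 0; 0, 0, r ^ 2, 0; 0, 0, 0, r ^ 2 * s ^ 2]

/-- The inverse of the Vaidya metric. -/
def inverseMetric (a r s : ℝ) : Matrix (Fin 4) (Fin 4) ℝ :=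
  !![0, -1, 0, 0; -1, 1 - 2 * a / r, 0, 0; 0, 0, (r ^ 2)⁻¹, 0; 0, 0, 0, (r ^ 2 * s ^ 2)⁻¹]

/-- The Christoffel symbols of the Vaidya metric, as functions of `a = m(u)`, `b = m'(u)`, `r`,
`s = sin θ` and `c = cos θ`; the upper index comes first. -/
def christoffelTable (a b r s c : ℝ) : Fin 4 → Matrix (Fin 4) (Fin 4) ℝ :=
  ![!![-(a / r ^ 2), 0, 0, 0; 0, 0, 0, 0; 0, 0, r, 0; 0, 0, 0, r * s ^ 2],
    !![(1 - 2 * a / r) * (a / r ^ 2) - b / r, a / r ^ 2, 0, 0;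
       a / r ^ 2, 0, 0, 0; 0, 0, 2 * a - r, 0; 0, 0, 0, (2 * a - r) * s ^ 2],
    !![0, 0, 0, 0; 0, 0, 1 / r, 0; 0, 1 / r, 0, 0; 0, 0, 0, -(s * c)],
    !![0, 0, 0, 0; 0, 0, 0, 1 / r; 0, 0, 0, c / s; 0, 1 / r, c / s, 0]]

/-- The derivative of `radial` along a path with velocity `(a', r')`. -/
def radialDeriv (a r a' r' : ℝ) : Matrix (Fin 4) (Fin 4) ℝ :=
  !![2 * a' / r - 2 * a * r' / r ^ 2, 0, 0, 0; 0, 0, 0, 0; 0, 0, 0, 0; 0, 0, 0, 0]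

/-- The derivative of `spherical` along a path with velocity `(r', s')`. -/
def sphericalDeriv (r s r' s' : ℝ) : Matrix (Fin 4) (Fin 4) ℝ :=
  !![0, 0, 0, 0; 0, 0, 0, 0; 0, 0, 2 * r * r', 0;
     0, 0, 0, 2 * r * r' * s ^ 2 + r ^ 2 * (2 * s * s')]

/-- The derivative of `christoffelTable` along a path with velocity `(a', b', r', s', c')`. -/
def christoffelTableDeriv (a b r s c a' b' r' s' c' : ℝ) : Fin 4 → Matrix (Fin 4) (Fin 4) ℝ :=
  let q := a' / r ^ 2 - 2 * a * r' / r ^ 3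
  let w := (c' * s - c * s') / s ^ 2
  ![!![-q, 0, 0, 0; 0, 0, 0, 0; 0, 0, r', 0; 0, 0, 0, r' * s ^ 2 + r * (2 * s * s')],
    !![(1 - 2 * a / r) * q - (2 * a' / r - 2 * a * r' / r ^ 2) * (a / r ^ 2)
        - (b' / r - b * r' / r ^ 2), q, 0, 0;
       q, 0, 0, 0; 0, 0, 2 * a' - r', 0;
       0, 0, 0, (2 * a' - r') * s ^ 2 + (2 * a - r) * (2 * s * s')],
    !![0, 0, 0, 0; 0, 0, -r' / r ^ 2, 0; 0, -r' / r ^ 2, 0, 0; 0, 0, 0, -(s' * c + s * c')],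
    !![0, 0, 0, 0; 0, 0, 0, -r' / r ^ 2; 0, 0, 0, w; 0, -r' / r ^ 2, w, 0]]

theorem hasDerivAt_radial {a r : ℝ → ℝ} {a' r' t : ℝ} (ha : HasDerivAt a a' t)
    (hr : HasDerivAt r r' t) (h : r t ≠ 0) (i j : Fin 4) :
    HasDerivAt (fun τ => radial (a τ) (r τ) i j) (radialDeriv (a t) (r t) a' r' i j) t := by
  have hf : HasDerivAt (fun τ => -(1 - 2 * a τ / r τ)) (2 * a' / r t - 2 * a t * r' / r t ^ 2) t :=
    (((ha.const_mul 2).fun_div hr h).const_sub 1).fun_neg.congr_deriv (by field_simp)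
  fin_cases i <;> fin_cases j <;>
    first | exact hf | exact hasDerivAt_const t _

theorem hasDerivAt_spherical {r s : ℝ → ℝ} {r' s' t : ℝ} (hr : HasDerivAt r r' t)
    (hs : HasDerivAt s s' t) (i j : Fin 4) :
    HasDerivAt (fun τ => spherical (r τ) (s τ) i j) (sphericalDeriv (r t) (s t) r' s' i j) t := by
  have hr2 : HasDerivAt (fun τ => r τ ^ 2) (2 * r t * r') t :=
    (hr.fun_pow 2).congr_deriv (by simp)
  have hs2 : HasDerivAt (fun τ => s τ ^ 2) (2 * s t * s') t :=
    (hs.fun_pow 2).congr_deriv (by simp)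
  fin_cases i <;> fin_cases j <;>
    first | exact hr2 | exact hr2.mul hs2 | exact hasDerivAt_const t _

theorem hasDerivAt_christoffelTable {a b r s c : ℝ → ℝ} {a' b' r' s' c' t : ℝ}
    (ha : HasDerivAt a a' t) (hb : HasDerivAt b b' t) (hr : HasDerivAt r r' t)
    (hs : HasDerivAt s s' t) (hc : HasDerivAt c c' t) (hr0 : r t ≠ 0) (hs0 : s t ≠ 0)
    (p i j : Fin 4) :
    HasDerivAt (fun τ => christoffelTable (a τ) (b τ) (r τ) (s τ) (c τ) p i j)
      (christoffelTableDeriv (a t) (b t) (r t) (s t) (c t) a' b' r' s' c' p i j) t := by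
  have hs2 : HasDerivAt (fun τ => s τ ^ 2) (2 * s t * s') t :=
    (hs.fun_pow 2).congr_deriv (by simp)
  have hq : HasDerivAt (fun τ => a τ / r τ ^ 2) (a' / r t ^ 2 - 2 * a t * r' / r t ^ 3) t :=
    (ha.fun_div (hr.fun_pow 2) (pow_ne_zero 2 hr0)).congr_deriv (by field_simp; ring)
  have hf : HasDerivAt (fun τ => 1 - 2 * a τ / r τ) (-(2 * a' / r t - 2 * a t * r' / r t ^ 2)) t :=
    (((ha.const_mul 2).fun_div hr hr0).const_sub 1).congr_deriv (by field_simp)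
  have hb1 : HasDerivAt (fun τ => b τ / r τ) (b' / r t - b t * r' / r t ^ 2) t :=
    (hb.fun_div hr hr0).congr_deriv (by field_simp)
  have h11 : HasDerivAt (fun τ => (1 - 2 * a τ / r τ) * (a τ / r τ ^ 2) - b τ / r τ)
      ((1 - 2 * a t / r t) * (a' / r t ^ 2 - 2 * a t * r' / r t ^ 3)
        - (2 * a' / r t - 2 * a t * r' / r t ^ 2) * (a t / r t ^ 2)
        - (b' / r t - b t * r' / r t ^ 2)) t :=
    ((hf.mul hq).sub hb1).congr_deriv (by ring)
  have hg : HasDerivAt (fun τ => 2 * a τ - r τ) (2 * a' - r') t := (ha.const_mul 2).sub hr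
  have hi : HasDerivAt (fun τ => 1 / r τ) (-r' / r t ^ 2) t :=
    ((hasDerivAt_const t 1).fun_div hr hr0).congr_deriv (by simp)
  have hw : HasDerivAt (fun τ => c τ / s τ) ((c' * s t - c t * s') / s t ^ 2) t :=
    hc.fun_div hs hs0
  have hsc : HasDerivAt (fun τ => -(s τ * c τ)) (-(s' * c t + s t * c')) t := (hs.mul hc).neg
  fin_cases p <;> fin_cases i <;> fin_cases j <;>
    first
    | exact hasDerivAt_const t _ | exact hq | exact hi | exact hw | exact hr | exact hg
    | exact hq.neg | exact hsc | exact hr.mul hs2 | exact hg.mul hs2 | exact h11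

/-! ### Curvature of the Vaidya metric -/

theorem vaidya_eq (m : ℝ → ℝ) (x : Fin 4 → ℝ) :
    vaidya m x = radial (m (x 0)) (x 1) + spherical (x 1) (Real.sin (x 2)) := by
  ext i j
  fin_cases i <;> fin_cases j <;> simp [vaidya, radial, spherical]

theorem vaidya_mul_inverseMetric (m : ℝ → ℝ) {x : Fin 4 → ℝ} (hr : x 1 ≠ 0)
    (hs : Real.sin (x 2) ≠ 0) :
    vaidya m x * inverseMetric (m (x 0)) (x 1) (Real.sin (x 2)) = 1 := by
  ext i j
  fin_cases i <;> fin_cases j <;>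
    simp [vaidya, inverseMetric, Matrix.mul_apply, Fin.sum_univ_four, hr] <;> field_simp

theorem vaidya_inv (m : ℝ → ℝ) {x : Fin 4 → ℝ} (hr : x 1 ≠ 0) (hs : Real.sin (x 2) ≠ 0) :
    (vaidya m x)⁻¹ = inverseMetric (m (x 0)) (x 1) (Real.sin (x 2)) :=
  Matrix.inv_eq_right_inv (vaidya_mul_inverseMetric m hr hs)

theorem isUnit_det_vaidya (m : ℝ → ℝ) {x : Fin 4 → ℝ} (hr : x 1 ≠ 0) (hs : Real.sin (x 2) ≠ 0) :
    IsUnit (vaidya m x).det :=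
  (Matrix.isUnit_iff_isUnit_det _).1 (IsUnit.of_mul_eq_one _ (vaidya_mul_inverseMetric m hr hs))

theorem vaidya_isSymm (m : ℝ → ℝ) (x : Fin 4 → ℝ) : (vaidya m x).IsSymm := by
  ext i j
  fin_cases i <;> fin_cases j <;> simp [vaidya]

theorem pd_vaidya (m : ℝ → ℝ) {x : Fin 4 → ℝ} (hm : DifferentiableAt ℝ m (x 0)) (hr : x 1 ≠ 0)
    (i j l : Fin 4) :
    pd i (fun y => vaidya m y j l) x =
      radialDeriv (m (x 0)) (x 1) (deriv m (x 0) * if i = 0 then 1 else 0)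
          (if i = 1 then 1 else 0) j l
        + sphericalDeriv (x 1) (Real.sin (x 2)) (if i = 1 then 1 else 0)
          (Real.cos (x 2) * if i = 2 then 1 else 0) j l := by
  have e : ∀ k, Function.update x i (x i) k = x k := fun k => by rw [Function.update_eq_self]
  have h0 : HasDerivAt (fun t => m (Function.update x i t 0))
      (deriv m (x 0) * if i = 0 then 1 else 0) (x i) := hasDerivAt_comp_coord hm i
  have h2 : HasDerivAt (fun t => Real.sin (Function.update x i t 2))
      (Real.cos (x 2) * if i = 2 then 1 else 0) (x i) := by
    simpa only [e] using (hasDerivAt_coord x i 2).sin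
  have h1 := hasDerivAt_coord x i 1
  have := (hasDerivAt_radial h0 h1 (by rwa [e]) j l).add (hasDerivAt_spherical h1 h2 j l)
  simp only [e] at this
  rw [← this.deriv]
  simp only [pd, vaidya_eq]
  rfl

theorem christoffel_vaidya (m : ℝ → ℝ) {x : Fin 4 → ℝ} (hm : DifferentiableAt ℝ m (x 0))
    (hr : x 1 ≠ 0) (hs : Real.sin (x 2) ≠ 0) (p i j : Fin 4) :
    christoffel (vaidya m) x p i j =
      christoffelTable (m (x 0)) (deriv m (x 0)) (x 1) (Real.sin (x 2)) (Real.cos (x 2)) p i j := by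
  simp only [christoffel, vaidya_inv m hr hs, pd_vaidya m hm hr, Fin.sum_univ_four]
  fin_cases p <;> fin_cases i <;> fin_cases j <;>
    simp [inverseMetric, radialDeriv, sphericalDeriv, christoffelTable] <;> field_simp <;> ring

/-- The projection onto the `(u, r)`-plane. -/
def radialProj : Matrix (Fin 4) (Fin 4) ℝ :=
  !![1, 0, 0, 0; 0, 1, 0, 0; 0, 0, 0, 0; 0, 0, 0, 0]

/-- The projection onto the tangent planes of the spheres. -/
def sphericalProj : Matrix (Fin 4) (Fin 4) ℝ :=
  !![0, 0, 0, 0; 0, 0, 0, 0; 0, 0, 1, 0; 0, 0, 0, 1]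

/-- The null covector `du`. -/
def du : Fin 4 → ℝ := ![1, 0, 0, 0]

/-- The gradient of `u`, the null vector `-∂_r`. -/
def gradU : Fin 4 → ℝ := ![0, -1, 0, 0]

/-- The `(1,3)`-Weyl tensor of the Vaidya metric: with the radial part `h` and the spherical part
`s` of the metric, it is `-(a/r³) (h ∧ h - h ∧ s + s ∧ s)` with the last index raised. -/
def weylMixed (a r s : ℝ) (i j k p : Fin 4) : ℝ :=
  -(a / r ^ 3) *
    (2 * (radial a r j k * radialProj i p - radial a r i k * radialProj j p)
      + 2 * (spherical r s j k * sphericalProj i p - spherical r s i k * sphericalProj j p)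
      - (radial a r j k * sphericalProj i p + spherical r s j k * radialProj i p
        - radial a r i k * sphericalProj j p - spherical r s i k * radialProj j p))

/-- The tensor `½ g ∧ S` with the last index raised, where `g = h + s` is the sum of the radial and
the spherical part and `S = σ du ⊗ du`. -/
def ricciPartMixed (σ a r s : ℝ) (i j k p : Fin 4) : ℝ :=
  σ / 2 * (du j * du k * (radialProj i p + sphericalProj i p)
    + (radial a r j k + spherical r s j k) * (du i * gradU p)
    - du i * du k * (radialProj j p + sphericalProj j p)
    - (radial a r i k + spherical r s i k) * (du j * gradU p))

theorem pd_christoffel_vaidya {m : ℝ → ℝ} {I : Set ℝ} (hI : IsOpen I) (hm : ContDiffOn ℝ ∞ m I)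
    {U : Set (Fin 4 → ℝ)} (hU : IsOpen U)
    (hdom : ∀ x ∈ U, x 0 ∈ I ∧ x 1 ≠ 0 ∧ Real.sin (x 2) ≠ 0) {x : Fin 4 → ℝ} (hx : x ∈ U)
    (i p j k : Fin 4) :
    pd i (fun y => christoffel (vaidya m) y p j k) x =
      christoffelTableDeriv (m (x 0)) (deriv m (x 0)) (x 1) (Real.sin (x 2)) (Real.cos (x 2))
        (deriv m (x 0) * if i = 0 then 1 else 0) (deriv (deriv m) (x 0) * if i = 0 then 1 else 0)
        (if i = 1 then 1 else 0) (Real.cos (x 2) * if i = 2 then 1 else 0)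
        (-Real.sin (x 2) * if i = 2 then 1 else 0) p j k := by
  have hd : ∀ u ∈ I, DifferentiableAt ℝ m u := fun u hu =>
    (hm.contDiffAt (hI.mem_nhds hu)).differentiableAt (by simp)
  have hd' : ∀ u ∈ I, DifferentiableAt ℝ (deriv m) u := fun u hu =>
    ((hm.deriv_of_isOpen (m := 1) hI (by norm_cast)).contDiffAt (hI.mem_nhds hu)).differentiableAt
      (by simp)
  obtain ⟨hxI, hr, hs⟩ := hdom x hx
  rw [pd_congr hU hx (fun y hy => christoffel_vaidya m (hd _ (hdom y hy).1) (hdom y hy).2.1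
    (hdom y hy).2.2 p j k)]
  have e : ∀ k, Function.update x i (x i) k = x k := fun k => by rw [Function.update_eq_self]
  have h0 : ∀ f : ℝ → ℝ, DifferentiableAt ℝ f (x 0) →
      HasDerivAt (fun t => f (Function.update x i t 0))
        (deriv f (x 0) * if i = 0 then 1 else 0) (x i) := fun f hf => hasDerivAt_comp_coord hf i
  have h2 := hasDerivAt_coord x i 2
  have := hasDerivAt_christoffelTable (h0 m (hd _ hxI)) (h0 _ (hd' _ hxI)) (hasDerivAt_coord x i 1)
    h2.sin h2.cos (by rwa [e]) (by rwa [e]) p j k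
  simp only [e] at this
  exact this.deriv

set_option maxHeartbeats 4000000 in
theorem curvOp_vaidya {m : ℝ → ℝ} {I : Set ℝ} (hI : IsOpen I) (hm : ContDiffOn ℝ ∞ m I)
    {U : Set (Fin 4 → ℝ)} (hU : IsOpen U)
    (hdom : ∀ x ∈ U, x 0 ∈ I ∧ x 1 ≠ 0 ∧ Real.sin (x 2) ≠ 0) {x : Fin 4 → ℝ} (hx : x ∈ U) :
    curvOp (vaidya m) x = weylMixed (m (x 0)) (x 1) (Real.sin (x 2))
      + ricciPartMixed (2 * deriv m (x 0) / x 1 ^ 2) (m (x 0)) (x 1) (Real.sin (x 2)) := by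
  have hd : DifferentiableAt ℝ m (x 0) :=
    (hm.contDiffAt (hI.mem_nhds (hdom x hx).1)).differentiableAt (by simp)
  obtain ⟨-, hr, hs⟩ := hdom x hx
  have hsc := Real.sin_sq_add_cos_sq (x 2)
  ext i j k p
  -- both sides are skew in `i, j`, so that it suffices to compare them for `i < j`
  have key : ∀ i j, i < j → ∀ k p, curvOp (vaidya m) x i j k p =
      (weylMixed (m (x 0)) (x 1) (Real.sin (x 2)) + ricciPartMixed (2 * deriv m (x 0) / x 1 ^ 2)
        (m (x 0)) (x 1) (Real.sin (x 2))) i j k p := by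
    intro i j hij k p
    simp only [curvOp, pd_christoffel_vaidya hI hm hU hdom hx, christoffel_vaidya m hd hr hs,
      Fin.sum_univ_four, Pi.add_apply]
    generalize Real.sin (x 2) = s at *
    generalize Real.cos (x 2) = c at *
    generalize x 1 = r at *
    generalize m (x 0) = a at *
    generalize deriv m (x 0) = b at *
    have hc2 : c ^ 2 = 1 - s ^ 2 := by linarith
    fin_cases i <;> fin_cases j <;> first | (exfalso; revert hij; decide) | skip
    all_goals
      fin_cases k <;> fin_cases p <;>
        simp [christoffelTable, christoffelTableDeriv, weylMixed, ricciPartMixed, radial, spherical,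
          radialProj, sphericalProj, du, gradU] <;> field_simp <;> (try rw [hc2]) <;> ring
  rcases lt_trichotomy i j with h | h | h
  · exact key i j h k p
  · subst h
    simp only [curvOp, weylMixed, ricciPartMixed, Pi.add_apply, sub_self, Finset.sum_const_zero]
    ring
  · have h1 : curvOp (vaidya m) x i j k p = -curvOp (vaidya m) x j i k p := by
      simp only [curvOp, neg_add, ← Finset.sum_neg_distrib, neg_sub]
    rw [h1, key j i h k p]
    simp only [weylMixed, ricciPartMixed, Pi.add_apply]
    ring

/-! ### The Weyl and the Ricci part of the curvature tensor -/

/-- The Weyl tensor `-(a/r³) (h ∧ h - h ∧ s + s ∧ s)` of the Vaidya metric, with the radial part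
`h` and the spherical part `s` of the metric. -/
def weylTensor (a r s : ℝ) : Tensor 4 4 :=
  (-(a / r ^ 3)) • (kulkarniNomizu (ofMatrix (radial a r)) (ofMatrix (radial a r))
    - kulkarniNomizu (ofMatrix (radial a r)) (ofMatrix (spherical r s))
    + kulkarniNomizu (ofMatrix (spherical r s)) (ofMatrix (spherical r s)))

/-- The tensor `½ g ∧ S` for `S = σ du ⊗ du`. -/
def ricciPart (σ a r s : ℝ) : Tensor 4 4 :=
  kulkarniNomizu (ofMatrix (radial a r) + ofMatrix (spherical r s)) ((σ / 4) • symProd du du)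

theorem radial_comm (a r : ℝ) (i j : Fin 4) : radial a r i j = radial a r j i := by
  fin_cases i <;> fin_cases j <;> rfl

theorem spherical_comm (r s : ℝ) (i j : Fin 4) : spherical r s i j = spherical r s j i := by
  fin_cases i <;> fin_cases j <;> rfl

theorem radialProj_radial (a r : ℝ) (i j : Fin 4) :
    ∑ p, radialProj i p * radial a r p j = radial a r i j := by
  fin_cases i <;> fin_cases j <;> simp [Fin.sum_univ_four, radialProj, radial]

theorem radialProj_spherical (r s : ℝ) (i j : Fin 4) :
    ∑ p, radialProj i p * spherical r s p j = 0 := by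
  fin_cases i <;> fin_cases j <;> simp [Fin.sum_univ_four, radialProj, spherical]

theorem sphericalProj_radial (a r : ℝ) (i j : Fin 4) :
    ∑ p, sphericalProj i p * radial a r p j = 0 := by
  fin_cases i <;> fin_cases j <;> simp [Fin.sum_univ_four, sphericalProj, radial]

theorem sphericalProj_spherical (r s : ℝ) (i j : Fin 4) :
    ∑ p, sphericalProj i p * spherical r s p j = spherical r s i j := by
  fin_cases i <;> fin_cases j <;> simp [Fin.sum_univ_four, sphericalProj, spherical]

theorem radialProj_du (i : Fin 4) : ∑ p, radialProj i p * du p = du i := by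
  fin_cases i <;> simp [Fin.sum_univ_four, radialProj, du]

theorem sphericalProj_du (i : Fin 4) : ∑ p, sphericalProj i p * du p = 0 := by
  fin_cases i <;> simp [Fin.sum_univ_four, sphericalProj, du]

theorem gradU_radial (a r : ℝ) (j : Fin 4) : ∑ p, gradU p * radial a r p j = du j := by
  fin_cases j <;> simp [Fin.sum_univ_four, gradU, radial, du]

theorem gradU_spherical (r s : ℝ) (j : Fin 4) : ∑ p, gradU p * spherical r s p j = 0 := by
  fin_cases j <;> simp [Fin.sum_univ_four, gradU, spherical]

theorem gradU_du : ∑ p, gradU p * du p = 0 := by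
  simp [Fin.sum_univ_four, gradU, du]

/-- The contraction of the `(1,3)`-Weyl tensor with a family `z` of scalars, in terms of the
contractions of the two projections. -/
theorem sum_weylMixed_mul (a r s : ℝ) (u v i : Fin 4) (z : Fin 4 → ℝ) :
    ∑ p, weylMixed a r s u v i p * z p = -(a / r ^ 3) *
      ((2 * radial a r v i - spherical r s v i) * (∑ p, radialProj u p * z p)
      - (2 * radial a r u i - spherical r s u i) * (∑ p, radialProj v p * z p)
      + (2 * spherical r s v i - radial a r v i) * (∑ p, sphericalProj u p * z p)
      - (2 * spherical r s u i - radial a r u i) * (∑ p, sphericalProj v p * z p)) := by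
  simp only [Fin.sum_univ_four, weylMixed]
  ring

theorem sum_ricciPartMixed_mul (σ a r s : ℝ) (u v i : Fin 4) (z : Fin 4 → ℝ) :
    ∑ p, ricciPartMixed σ a r s u v i p * z p = σ / 2 *
      (du v * du i * (∑ p, radialProj u p * z p + ∑ p, sphericalProj u p * z p)
      - du u * du i * (∑ p, radialProj v p * z p + ∑ p, sphericalProj v p * z p)
      + ((radial a r v i + spherical r s v i) * du u
        - (radial a r u i + spherical r s u i) * du v) * ∑ p, gradU p * z p) := by
  simp only [Fin.sum_univ_four, ricciPartMixed]
  ring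

theorem sum_wedgeEndo_mul {n : ℕ} (A : Tensor n 2) (u v i : Fin n) (z : Fin n → ℝ) :
    ∑ p, wedgeEndo A u v i p * z p = A ![u, i] * z v - A ![v, i] * z u := by
  simp [wedgeEndo, sub_mul, Finset.sum_sub_distrib, Matrix.one_apply]

theorem derivation_radial (L : Fin 4 → Fin 4 → ℝ) (a r : ℝ) (i j : Fin 4) :
    derivation L (ofMatrix (radial a r)) ![i, j] =
      ∑ p, L i p * radial a r p j + ∑ p, L j p * radial a r p i := by
  rw [derivation_two, ← Finset.sum_add_distrib]
  simp only [ofMatrix_apply, radial_comm a r i]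

theorem derivation_spherical (L : Fin 4 → Fin 4 → ℝ) (r s : ℝ) (i j : Fin 4) :
    derivation L (ofMatrix (spherical r s)) ![i, j] =
      ∑ p, L i p * spherical r s p j + ∑ p, L j p * spherical r s p i := by
  rw [derivation_two, ← Finset.sum_add_distrib]
  simp only [ofMatrix_apply, spherical_comm r s i]

theorem derivation_symProd_du (L : Fin 4 → Fin 4 → ℝ) (i j : Fin 4) :
    derivation L (symProd du du) ![i, j] =
      2 * (du j * (∑ p, L i p * du p) + du i * ∑ p, L j p * du p) := by
  rw [derivation_two]
  simp only [symProd_apply, Fin.sum_univ_four]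
  ring

theorem derivation_weylTensor (L : Fin 4 → Fin 4 → ℝ) (a r s : ℝ) :
    derivation L (weylTensor a r s) = (-(a / r ^ 3)) •
      (kulkarniNomizu (derivation L (ofMatrix (radial a r)))
          ((2 : ℝ) • ofMatrix (radial a r) - ofMatrix (spherical r s))
        + kulkarniNomizu (derivation L (ofMatrix (spherical r s)))
          ((2 : ℝ) • ofMatrix (spherical r s) - ofMatrix (radial a r))) := by
  rw [weylTensor, derivation_smul, derivation_add, derivation_sub]
  simp only [derivation_kulkarniNomizu]
  congr 1
  apply Tensor.ext_four
  intro i j k l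
  simp only [Pi.add_apply, Pi.sub_apply, Pi.smul_apply, kulkarniNomizu_apply, smul_eq_mul]
  ring

theorem derivation_ricciPart (L : Fin 4 → Fin 4 → ℝ) (σ a r s : ℝ) :
    derivation L (ricciPart σ a r s) = (σ / 4) •
      (kulkarniNomizu
          (derivation L (ofMatrix (radial a r)) + derivation L (ofMatrix (spherical r s)))
          (symProd du du)
        + kulkarniNomizu (ofMatrix (radial a r) + ofMatrix (spherical r s))
          (derivation L (symProd du du))) := by
  rw [ricciPart, derivation_kulkarniNomizu, derivation_add, derivation_smul, kulkarniNomizu_smul,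
    kulkarniNomizu_smul, smul_add]

/-! #### Values of the derivations on the building blocks of the curvature -/

/-- The covector `du(∂_u) B(∂_v, ·) - du(∂_v) B(∂_u, ·)` for the matrix `B` and the coordinate
vectors with the indices `u` and `v`. -/
def twist (B : Matrix (Fin 4) (Fin 4) ℝ) (u v i : Fin 4) : ℝ := du u * B v i - du v * B u i

/-- The Vaidya metric as a tensor at a point. -/
def metricTensor (a r s : ℝ) : Tensor 4 2 := ofMatrix (radial a r) + ofMatrix (spherical r s)

@[simp] theorem metricTensor_apply (a r s : ℝ) (i j : Fin 4) :
    metricTensor a r s ![i, j] = radial a r i j + spherical r s i j := rfl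

theorem derivation_wedge_metric_radial (a r s : ℝ) (u v i j : Fin 4) :
    derivation (wedgeEndo (metricTensor a r s) u v) (ofMatrix (radial a r)) ![i, j] =
      spherical r s u i * radial a r v j + spherical r s u j * radial a r v i
        - spherical r s v i * radial a r u j - spherical r s v j * radial a r u i := by
  simp only [derivation_radial, sum_wedgeEndo_mul, metricTensor_apply]
  ring

theorem derivation_wedge_metric_spherical (a r s : ℝ) (u v i j : Fin 4) :
    derivation (wedgeEndo (metricTensor a r s) u v) (ofMatrix (spherical r s)) ![i, j] =
      -(spherical r s u i * radial a r v j + spherical r s u j * radial a r v i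
        - spherical r s v i * radial a r u j - spherical r s v j * radial a r u i) := by
  simp only [derivation_spherical, sum_wedgeEndo_mul, metricTensor_apply]
  ring

theorem derivation_wedge_metric_du (a r s : ℝ) (u v i j : Fin 4) :
    derivation (wedgeEndo (metricTensor a r s) u v) (symProd du du) ![i, j] =
      -2 * symProd du (twist (radial a r) u v + twist (spherical r s) u v) ![i, j] := by
  simp only [derivation_symProd_du, sum_wedgeEndo_mul, metricTensor_apply, symProd_apply, twist,
    Pi.add_apply]
  ring

theorem derivation_weylMixed_radial (a r s : ℝ) (u v : Fin 4) :
    derivation (weylMixed a r s u v) (ofMatrix (radial a r)) = (-(a / r ^ 3)) •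
      derivation (wedgeEndo (metricTensor a r s) u v) (ofMatrix (radial a r)) := by
  apply Tensor.ext_two
  intro i j
  rw [Pi.smul_apply, derivation_wedge_metric_radial]
  simp only [derivation_radial, sum_weylMixed_mul, radialProj_radial, sphericalProj_radial,
    smul_eq_mul]
  ring

theorem derivation_weylMixed_spherical (a r s : ℝ) (u v : Fin 4) :
    derivation (weylMixed a r s u v) (ofMatrix (spherical r s)) = (-(a / r ^ 3)) •
      derivation (wedgeEndo (metricTensor a r s) u v) (ofMatrix (spherical r s)) := by
  apply Tensor.ext_two
  intro i j
  rw [Pi.smul_apply, derivation_wedge_metric_spherical]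
  simp only [derivation_spherical, sum_weylMixed_mul, radialProj_spherical,
    sphericalProj_spherical, smul_eq_mul]
  ring

theorem derivation_weylMixed_du (a r s : ℝ) (u v i j : Fin 4) :
    derivation (weylMixed a r s u v) (symProd du du) ![i, j] = -(a / r ^ 3) *
      (2 * symProd du ((2 : ℝ) • twist (radial a r) u v - twist (spherical r s) u v) ![i, j]) := by
  simp only [derivation_symProd_du, sum_weylMixed_mul, radialProj_du, sphericalProj_du,
    symProd_apply, twist, Pi.sub_apply, Pi.smul_apply, smul_eq_mul]
  ring

theorem derivation_ricciPartMixed_radial (σ a r s : ℝ) (u v i j : Fin 4) :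
    derivation (ricciPartMixed σ a r s u v) (ofMatrix (radial a r)) ![i, j] =
      σ / 2 * symProd du (twist (spherical r s) u v) ![i, j] := by
  simp only [derivation_radial, sum_ricciPartMixed_mul, radialProj_radial, sphericalProj_radial,
    gradU_radial, symProd_apply, twist]
  ring

theorem derivation_ricciPartMixed_spherical (σ a r s : ℝ) (u v i j : Fin 4) :
    derivation (ricciPartMixed σ a r s u v) (ofMatrix (spherical r s)) ![i, j] =
      -(σ / 2 * symProd du (twist (spherical r s) u v) ![i, j]) := by
  simp only [derivation_spherical, sum_ricciPartMixed_mul, radialProj_spherical,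
    sphericalProj_spherical, gradU_spherical, symProd_apply, twist]
  ring

theorem derivation_ricciPartMixed_du (σ a r s : ℝ) (u v : Fin 4) :
    derivation (ricciPartMixed σ a r s u v) (symProd du du) = 0 := by
  apply Tensor.ext_two
  intro i j
  simp only [derivation_symProd_du, sum_ricciPartMixed_mul, radialProj_du, sphericalProj_du,
    gradU_du, Pi.zero_apply]
  ring

theorem derivation_wedge_ricci_radial (σ a r : ℝ) (u v i j : Fin 4) :
    derivation (wedgeEndo ((σ / 2) • symProd du du) u v) (ofMatrix (radial a r)) ![i, j] =
      σ * symProd du (twist (radial a r) u v) ![i, j] := by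
  simp only [derivation_radial, sum_wedgeEndo_mul, Pi.smul_apply, smul_eq_mul, symProd_apply, twist]
  ring

theorem derivation_wedge_ricci_spherical (σ r s : ℝ) (u v i j : Fin 4) :
    derivation (wedgeEndo ((σ / 2) • symProd du du) u v) (ofMatrix (spherical r s)) ![i, j] =
      σ * symProd du (twist (spherical r s) u v) ![i, j] := by
  simp only [derivation_spherical, sum_wedgeEndo_mul, Pi.smul_apply, smul_eq_mul, symProd_apply,
    twist]
  ring

theorem derivation_wedge_ricci_du (σ : ℝ) (u v : Fin 4) :
    derivation (wedgeEndo ((σ / 2) • symProd du du) u v) (symProd du du) = 0 := by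
  apply Tensor.ext_two
  intro i j
  simp only [derivation_symProd_du, sum_wedgeEndo_mul, Pi.smul_apply, smul_eq_mul, symProd_apply,
    Pi.zero_apply]
  ring

/-- The covector `ω` with `h = du ⊗ ω + ω ⊗ du` for the radial part `h` of the metric. -/
def radialFactor (a r : ℝ) : Fin 4 → ℝ := ![-(1 - 2 * a / r) / 2, -1, 0, 0]

theorem radial_eq_symProd (a r : ℝ) (i j : Fin 4) :
    radial a r i j = du i * radialFactor a r j + radialFactor a r i * du j := by
  fin_cases i <;> fin_cases j <;> simp [radial, du, radialFactor]

/-- `C · C = (m/r³) Q(g, C)`, for the derivations. -/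
theorem derivation_weylMixed_weylTensor (a r s : ℝ) (u v : Fin 4) :
    derivation (weylMixed a r s u v) (weylTensor a r s) = (-(a / r ^ 3)) •
      derivation (wedgeEndo (metricTensor a r s) u v) (weylTensor a r s) := by
  simp only [derivation_weylTensor, derivation_weylMixed_radial, derivation_weylMixed_spherical,
    smul_kulkarniNomizu, smul_add]

/-- The mixed terms `(½ g ∧ S) · C + C · (½ g ∧ S)` add up to `Q(S, C)`, for the derivations. The
radial part of the metric drops out of the products with `du` because it is itself such a
product. -/
theorem derivation_mixed_terms (σ a r s : ℝ) (u v : Fin 4) :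
    derivation (ricciPartMixed σ a r s u v) (weylTensor a r s)
        + derivation (weylMixed a r s u v) (ricciPart σ a r s)
      = -derivation (wedgeEndo ((σ / 2) • symProd du du) u v) (weylTensor a r s) := by
  rw [derivation_weylTensor, derivation_weylTensor, derivation_ricciPart]
  apply Tensor.ext_four
  intro i j k l
  simp only [Pi.add_apply, Pi.sub_apply, Pi.smul_apply, Pi.neg_apply, kulkarniNomizu_apply,
    smul_eq_mul, derivation_weylMixed_radial,
    derivation_weylMixed_spherical, derivation_wedge_metric_radial,
    derivation_wedge_metric_spherical, derivation_weylMixed_du, derivation_ricciPartMixed_radial,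
    derivation_ricciPartMixed_spherical, derivation_wedge_ricci_radial,
    derivation_wedge_ricci_spherical, symProd_apply, ofMatrix_apply, twist, radial_eq_symProd]
  ring

/-- `(½ g ∧ S) · (½ g ∧ S) = 0`. -/
theorem derivation_ricciPartMixed_ricciPart (σ a r s : ℝ) (u v : Fin 4) :
    derivation (ricciPartMixed σ a r s u v) (ricciPart σ a r s) = 0 := by
  rw [derivation_ricciPart, derivation_ricciPartMixed_du]
  apply Tensor.ext_four
  intro i j k l
  simp only [Pi.add_apply, Pi.smul_apply, kulkarniNomizu_apply, derivation_ricciPartMixed_radial,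
    derivation_ricciPartMixed_spherical, Pi.zero_apply, smul_eq_mul]
  ring

/-- `Q(S, ½ g ∧ S) = 0`. -/
theorem derivation_wedge_ricci_ricciPart (σ a r s : ℝ) (u v : Fin 4) :
    derivation (wedgeEndo ((σ / 2) • symProd du du) u v) (ricciPart σ a r s) = 0 := by
  rw [derivation_ricciPart, derivation_wedge_ricci_du]
  apply Tensor.ext_four
  intro i j k l
  simp only [Pi.add_apply, Pi.smul_apply, kulkarniNomizu_apply, derivation_wedge_ricci_radial,
    derivation_wedge_ricci_spherical, symProd_apply, Pi.zero_apply, smul_eq_mul]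
  ring

/-! ### The curvature tensors of the Vaidya metric -/

/-- The decomposition `𝓡 = 𝓒 + ½ g ∧ S` of the `(1,3)`-curvature tensor of the Vaidya metric at the
point `x`. It is stated separately because all further computations at a point only use this value
of the curvature, and no derivatives of the metric. -/
def HasVaidyaCurvature (m : ℝ → ℝ) (x : Fin 4 → ℝ) : Prop :=
  curvOp (vaidya m) x = weylMixed (m (x 0)) (x 1) (Real.sin (x 2))
    + ricciPartMixed (2 * deriv m (x 0) / x 1 ^ 2) (m (x 0)) (x 1) (Real.sin (x 2))

theorem metric_vaidya (m : ℝ → ℝ) (x : Fin 4 → ℝ) :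
    metric (vaidya m) x = metricTensor (m (x 0)) (x 1) (Real.sin (x 2)) := by
  rw [metric, vaidya_eq]; rfl

theorem lower_weylMixed (a r s : ℝ) :
    (fun I : Fin 4 → Fin 4 => ∑ p, weylMixed a r s (I 0) (I 1) (I 2) p
      * (radial a r + spherical r s) p (I 3)) = weylTensor a r s := by
  apply Tensor.ext_four
  intro i j k l
  simp only [Matrix.cons_val, weylTensor, sum_weylMixed_mul, Matrix.add_apply, mul_add,
    Finset.sum_add_distrib, radialProj_radial, radialProj_spherical, sphericalProj_radial,
    sphericalProj_spherical, Pi.smul_apply, Pi.add_apply, Pi.sub_apply, kulkarniNomizu_apply,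
    ofMatrix_apply, smul_eq_mul]
  ring

theorem lower_ricciPartMixed (σ a r s : ℝ) :
    (fun I : Fin 4 → Fin 4 => ∑ p, ricciPartMixed σ a r s (I 0) (I 1) (I 2) p
      * (radial a r + spherical r s) p (I 3)) = ricciPart σ a r s := by
  apply Tensor.ext_four
  intro i j k l
  simp only [Matrix.cons_val, ricciPart, sum_ricciPartMixed_mul, Matrix.add_apply, mul_add,
    Finset.sum_add_distrib, radialProj_radial, radialProj_spherical, sphericalProj_radial,
    sphericalProj_spherical, gradU_radial, gradU_spherical, Pi.smul_apply, Pi.add_apply,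
    kulkarniNomizu_apply, ofMatrix_apply, symProd_apply, smul_eq_mul]
  ring

theorem raise_weylTensor (m : ℝ → ℝ) {x : Fin 4 → ℝ} (hr : x 1 ≠ 0) (hs : Real.sin (x 2) ≠ 0) :
    raise (vaidya m x) (weylTensor (m (x 0)) (x 1) (Real.sin (x 2))) =
      weylMixed (m (x 0)) (x 1) (Real.sin (x 2)) := by
  rw [← lower_weylMixed, ← vaidya_eq, raise_lower _ (isUnit_det_vaidya m hr hs)]

theorem riemann_vaidya {m : ℝ → ℝ} {x : Fin 4 → ℝ} (h : HasVaidyaCurvature m x) :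
    riemann (vaidya m) x = weylTensor (m (x 0)) (x 1) (Real.sin (x 2))
      + ricciPart (2 * deriv m (x 0) / x 1 ^ 2) (m (x 0)) (x 1) (Real.sin (x 2)) := by
  rw [← lower_weylMixed, ← lower_ricciPartMixed]
  ext I
  rw [riemann, h, vaidya_eq]
  simp only [Pi.add_apply, add_mul, Finset.sum_add_distrib]

theorem ricci_vaidya {m : ℝ → ℝ} {x : Fin 4 → ℝ} (h : HasVaidyaCurvature m x) :
    ricci (vaidya m) x = (2 * deriv m (x 0) / x 1 ^ 2 / 2) • symProd du du := by
  apply Tensor.ext_two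
  intro i j
  rw [ricci, h]
  simp only [Pi.add_apply, Fin.sum_univ_four, Pi.smul_apply, symProd_apply, smul_eq_mul,
    Matrix.cons_val]
  generalize 2 * deriv m (x 0) / x 1 ^ 2 = σ
  fin_cases i <;> fin_cases j <;>
    simp [weylMixed, ricciPartMixed, radial, spherical, radialProj, sphericalProj, du, gradU] <;>
    ring

theorem scalarCurv_vaidya {m : ℝ → ℝ} {x : Fin 4 → ℝ} (h : HasVaidyaCurvature m x)
    (hr : x 1 ≠ 0) (hs : Real.sin (x 2) ≠ 0) : scalarCurv (vaidya m) x = 0 := by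
  simp [scalarCurv, ricci_vaidya h, vaidya_inv m hr hs, Fin.sum_univ_four, du, inverseMetric]

theorem conharmonic_vaidya {m : ℝ → ℝ} {x : Fin 4 → ℝ} (h : HasVaidyaCurvature m x) :
    conharmonic (vaidya m) x = weylTensor (m (x 0)) (x 1) (Real.sin (x 2)) := by
  have e : (1 / ((4 : ℕ) - 2 : ℝ)) * (2 * deriv m (x 0) / x 1 ^ 2 / 2) =
      2 * deriv m (x 0) / x 1 ^ 2 / 4 := by
    norm_num; ring
  rw [conharmonic, riemann_vaidya h, metric_vaidya, ricci_vaidya h, kulkarniNomizu_smul, smul_smul,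
    e, ricciPart, kulkarniNomizu_smul, metricTensor, add_sub_cancel_right]

theorem weyl_vaidya {m : ℝ → ℝ} {x : Fin 4 → ℝ} (h : HasVaidyaCurvature m x)
    (hr : x 1 ≠ 0) (hs : Real.sin (x 2) ≠ 0) :
    weyl (vaidya m) x = weylTensor (m (x 0)) (x 1) (Real.sin (x 2)) := by
  rw [weyl, scalarCurv_vaidya h hr hs, conharmonic_vaidya h, zero_div, zero_smul, add_zero]

theorem concircular_vaidya {m : ℝ → ℝ} {x : Fin 4 → ℝ} (h : HasVaidyaCurvature m x)
    (hr : x 1 ≠ 0) (hs : Real.sin (x 2) ≠ 0) :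
    concircular (vaidya m) x = riemann (vaidya m) x := by
  rw [concircular, scalarCurv_vaidya h hr hs, zero_div, zero_smul, sub_zero]

theorem raise_riemann_vaidya {m : ℝ → ℝ} {x : Fin 4 → ℝ} (h : HasVaidyaCurvature m x)
    (hr : x 1 ≠ 0) (hs : Real.sin (x 2) ≠ 0) :
    raise (vaidya m x) (riemann (vaidya m) x) = weylMixed (m (x 0)) (x 1) (Real.sin (x 2))
      + ricciPartMixed (2 * deriv m (x 0) / x 1 ^ 2) (m (x 0)) (x 1) (Real.sin (x 2)) := by
  have := raise_lower (vaidya m x) (isUnit_det_vaidya m hr hs) (curvOp (vaidya m) x)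
  rw [h] at this
  rw [← this, ← h]
  rfl

theorem raise_weyl_vaidya {m : ℝ → ℝ} {x : Fin 4 → ℝ} (h : HasVaidyaCurvature m x)
    (hr : x 1 ≠ 0) (hs : Real.sin (x 2) ≠ 0) :
    raise (vaidya m x) (weyl (vaidya m) x) = weylMixed (m (x 0)) (x 1) (Real.sin (x 2)) := by
  rw [weyl_vaidya h hr hs, raise_weylTensor m hr hs]

/-! ### Conditions of pseudosymmetric type -/

theorem dot_weyl_weyl {m : ℝ → ℝ} {x : Fin 4 → ℝ} (h : HasVaidyaCurvature m x)
    (hr : x 1 ≠ 0) (hs : Real.sin (x 2) ≠ 0) :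
    dot (vaidya m x) (weyl (vaidya m) x) (weyl (vaidya m) x) =
      (m (x 0) / x 1 ^ 3) • tachibana (metric (vaidya m) x) (weyl (vaidya m) x) := by
  ext I u v
  simp only [Pi.smul_apply, dot_eq_derivation, tachibana_eq_derivation, raise_weyl_vaidya h hr hs,
    metric_vaidya]
  rw [weyl_vaidya h hr hs, derivation_weylMixed_weylTensor, Pi.smul_apply, smul_eq_mul,
    smul_eq_mul]
  ring

theorem dot_riemann_riemann_sub {m : ℝ → ℝ} {x : Fin 4 → ℝ} (h : HasVaidyaCurvature m x)
    (hr : x 1 ≠ 0) (hs : Real.sin (x 2) ≠ 0) :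
    dot (vaidya m x) (riemann (vaidya m) x) (riemann (vaidya m) x)
        - tachibana (ricci (vaidya m) x) (riemann (vaidya m) x) =
      (m (x 0) / x 1 ^ 3) • tachibana (metric (vaidya m) x) (weyl (vaidya m) x) := by
  ext I u v
  simp only [Pi.smul_apply, Pi.sub_apply, dot_eq_derivation, tachibana_eq_derivation,
    raise_riemann_vaidya h hr hs, metric_vaidya, Pi.add_apply]
  rw [weyl_vaidya h hr hs, riemann_vaidya h, ricci_vaidya h, add_derivation, derivation_add,
    derivation_add, derivation_add, derivation_weylMixed_weylTensor,
    derivation_ricciPartMixed_ricciPart, derivation_wedge_ricci_ricciPart]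
  have := congrFun (derivation_mixed_terms (2 * deriv m (x 0) / x 1 ^ 2) (m (x 0)) (x 1)
    (Real.sin (x 2)) u v) I
  simp only [Pi.add_apply, Pi.smul_apply, Pi.neg_apply, Pi.zero_apply, smul_eq_mul] at this ⊢
  linear_combination -this

theorem dot_riemann_weyl_add {m : ℝ → ℝ} {x : Fin 4 → ℝ} (h : HasVaidyaCurvature m x)
    (hr : x 1 ≠ 0) (hs : Real.sin (x 2) ≠ 0) :
    dot (vaidya m x) (riemann (vaidya m) x) (weyl (vaidya m) x)
        + dot (vaidya m x) (weyl (vaidya m) x) (riemann (vaidya m) x) =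
      (2 * m (x 0) / x 1 ^ 3) • tachibana (metric (vaidya m) x) (weyl (vaidya m) x)
        + tachibana (ricci (vaidya m) x) (weyl (vaidya m) x) := by
  ext I u v
  simp only [Pi.smul_apply, dot_eq_derivation, tachibana_eq_derivation,
    raise_riemann_vaidya h hr hs, raise_weyl_vaidya h hr hs, metric_vaidya, Pi.add_apply]
  rw [weyl_vaidya h hr hs, riemann_vaidya h, ricci_vaidya h, add_derivation, derivation_add,
    derivation_weylMixed_weylTensor]
  have := congrFun (derivation_mixed_terms (2 * deriv m (x 0) / x 1 ^ 2) (m (x 0)) (x 1)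
    (Real.sin (x 2)) u v) I
  simp only [Pi.add_apply, Pi.smul_apply, Pi.neg_apply, smul_eq_mul] at this ⊢
  linear_combination -this

/-! The tensors are evaluated on the arguments `(∂_θ, ∂_u, ∂_r, ∂_u; ∂_r, ∂_θ)` and
`(∂_θ, ∂_u, ∂_r, ∂_u; ∂_u, ∂_θ)`. On the first ones the terms that involve `S` vanish, on the second
ones `Q(g, C)` vanishes, so that the two coefficients of a linear relation are separated. -/

theorem tachibana_metric_weyl_rθ (a r s : ℝ) (hr : r ≠ 0) :
    tachibana (metricTensor a r s) (weylTensor a r s) ![2, 0, 1, 0] 1 2 = 3 * a / r := by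
  rw [tachibana_eq_derivation, derivation_weylTensor]
  simp only [Pi.add_apply, Pi.sub_apply, Pi.smul_apply, kulkarniNomizu_apply, smul_eq_mul,
    ofMatrix_apply, derivation_wedge_metric_radial,
    derivation_wedge_metric_spherical]
  simp [radial, spherical]
  field_simp
  norm_num

theorem tachibana_metric_ricciPart_rθ (σ a r s : ℝ) :
    tachibana (metricTensor a r s) (ricciPart σ a r s) ![2, 0, 1, 0] 1 2 = 0 := by
  rw [tachibana_eq_derivation, derivation_ricciPart]
  simp only [Pi.add_apply, Pi.smul_apply, kulkarniNomizu_apply, smul_eq_mul,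
    ofMatrix_apply, symProd_apply, derivation_wedge_metric_radial,
    derivation_wedge_metric_spherical, derivation_wedge_metric_du]
  simp [radial, spherical, du, twist]

theorem tachibana_ricci_weyl_rθ (σ a r s : ℝ) :
    tachibana ((σ / 2) • symProd du du) (weylTensor a r s) ![2, 0, 1, 0] 1 2 = 0 := by
  rw [tachibana_eq_derivation, derivation_weylTensor]
  simp only [Pi.add_apply, Pi.sub_apply, Pi.smul_apply, kulkarniNomizu_apply, smul_eq_mul,
    ofMatrix_apply, symProd_apply, derivation_wedge_ricci_radial, derivation_wedge_ricci_spherical]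
  simp [radial, spherical, du, twist]

theorem tachibana_metric_weyl_uθ (a r s : ℝ) :
    tachibana (metricTensor a r s) (weylTensor a r s) ![2, 0, 1, 0] 0 2 = 0 := by
  rw [tachibana_eq_derivation, derivation_weylTensor]
  simp only [Pi.add_apply, Pi.sub_apply, Pi.smul_apply, kulkarniNomizu_apply, smul_eq_mul,
    ofMatrix_apply, derivation_wedge_metric_radial,
    derivation_wedge_metric_spherical]
  simp [radial, spherical]
  exact Or.inr (by ring)

theorem tachibana_metric_ricciPart_uθ (σ a r s : ℝ) :
    tachibana (metricTensor a r s) (ricciPart σ a r s) ![2, 0, 1, 0] 0 2 = σ * r ^ 2 / 2 := by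
  rw [tachibana_eq_derivation, derivation_ricciPart]
  simp only [Pi.add_apply, Pi.smul_apply, kulkarniNomizu_apply, smul_eq_mul,
    ofMatrix_apply, symProd_apply, derivation_wedge_metric_radial,
    derivation_wedge_metric_spherical, derivation_wedge_metric_du]
  simp [radial, spherical, du, twist]
  ring

theorem tachibana_ricci_weyl_uθ (σ a r s : ℝ) (hr : r ≠ 0) :
    tachibana ((σ / 2) • symProd du du) (weylTensor a r s) ![2, 0, 1, 0] 0 2 = -(a * σ / r) := by
  rw [tachibana_eq_derivation, derivation_weylTensor]
  simp only [Pi.add_apply, Pi.sub_apply, Pi.smul_apply, kulkarniNomizu_apply, smul_eq_mul,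
    ofMatrix_apply, symProd_apply, derivation_wedge_ricci_radial, derivation_wedge_ricci_spherical]
  simp [radial, spherical, du, twist]
  field_simp

theorem derivation_ricciPartMixed_weyl_rθ (σ a r s : ℝ) :
    derivation (ricciPartMixed σ a r s 1 2) (weylTensor a r s) ![2, 0, 1, 0] = 0 := by
  rw [derivation_weylTensor]
  simp only [Pi.add_apply, Pi.sub_apply, Pi.smul_apply, kulkarniNomizu_apply, smul_eq_mul,
    ofMatrix_apply, symProd_apply, derivation_ricciPartMixed_radial,
    derivation_ricciPartMixed_spherical]
  simp [radial, spherical, du, twist]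

theorem derivation_ricciPartMixed_weyl_uθ (σ a r s : ℝ) (hr : r ≠ 0) :
    derivation (ricciPartMixed σ a r s 0 2) (weylTensor a r s) ![2, 0, 1, 0] =
      3 * a * σ / (2 * r) := by
  rw [derivation_weylTensor]
  simp only [Pi.add_apply, Pi.sub_apply, Pi.smul_apply, kulkarniNomizu_apply, smul_eq_mul,
    ofMatrix_apply, symProd_apply, derivation_ricciPartMixed_radial,
    derivation_ricciPartMixed_spherical]
  simp [radial, spherical, du, twist]
  field_simp
  norm_num

theorem gaussian_eq {n : ℕ} (g : Metric n) (x : Fin n → ℝ) :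
    gaussian g x = wedgeTensor (g x) (metric g x) := rfl

theorem not_deszczPseudosymmetric {m : ℝ → ℝ} {U : Set (Fin 4 → ℝ)} {x : Fin 4 → ℝ} (hx : x ∈ U)
    (h : HasVaidyaCurvature m x) (hr : x 1 ≠ 0) (hs : Real.sin (x 2) ≠ 0) (hm : m (x 0) ≠ 0)
    (hm' : deriv m (x 0) ≠ 0) : ¬ DeszczPseudosymmetric (vaidya m) U := by
  rintro ⟨c₁, c₂, hc⟩
  obtain ⟨hne, h0⟩ := hc x hx
  have hRR : dot (vaidya m x) (riemann (vaidya m) x) (riemann (vaidya m) x) =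
      tachibana (ricci (vaidya m) x) (riemann (vaidya m) x)
        + (m (x 0) / x 1 ^ 3) • tachibana (metric (vaidya m) x) (weyl (vaidya m) x) := by
    rw [← dot_riemann_riemann_sub h hr hs]; abel
  rw [dot_add, dot_smul, dot_smul, gaussian_eq, dot_wedgeTensor _ (isUnit_det_vaidya m hr hs),
    hRR] at h0
  have hq : ∀ A u v, tachibana A (riemann (vaidya m) x) ![2, 0, 1, 0] u v =
      tachibana A (weylTensor (m (x 0)) (x 1) (Real.sin (x 2))) ![2, 0, 1, 0] u v
      + tachibana A (ricciPart (2 * deriv m (x 0) / x 1 ^ 2) (m (x 0)) (x 1) (Real.sin (x 2)))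
        ![2, 0, 1, 0] u v := fun A u v => by
    simp only [tachibana_eq_derivation, riemann_vaidya h, derivation_add, Pi.add_apply]
  have hS : ∀ u v, tachibana ((2 * deriv m (x 0) / x 1 ^ 2 / 2) • symProd du du)
      (ricciPart (2 * deriv m (x 0) / x 1 ^ 2) (m (x 0)) (x 1) (Real.sin (x 2)))
        ![2, 0, 1, 0] u v = 0 := fun u v => by
    rw [tachibana_eq_derivation, derivation_wedge_ricci_ricciPart]; rfl
  have e1 := congrFun (congrFun (congrFun h0 ![2, 0, 1, 0]) 1) 2
  have e2 := congrFun (congrFun (congrFun h0 ![2, 0, 1, 0]) 0) 2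
  simp only [Pi.add_apply, Pi.smul_apply, Pi.zero_apply, smul_eq_mul, hq, metric_vaidya,
    weyl_vaidya h hr hs, ricci_vaidya h, hS, tachibana_metric_weyl_rθ _ _ _ hr,
    tachibana_metric_ricciPart_rθ, tachibana_ricci_weyl_rθ, tachibana_metric_weyl_uθ,
    tachibana_metric_ricciPart_uθ, tachibana_ricci_weyl_uθ _ _ _ _ hr] at e1 e2
  have f1 : c₂ x = -(c₁ x * m (x 0) / x 1 ^ 3) := by
    have : m (x 0) * (c₂ x * x 1 ^ 3 + c₁ x * m (x 0)) = 0 := by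
      field_simp at e1
      linear_combination e1 / 3
    have := (mul_eq_zero.1 this).resolve_left hm
    field_simp
    linear_combination this
  have f2 : c₁ x = 0 := by
    rw [f1] at e2
    have : c₁ x * (m (x 0) * deriv m (x 0)) = 0 := by
      field_simp at e2
      linarith
    exact (mul_eq_zero.1 this).resolve_right (mul_ne_zero hm hm')
  rw [f2] at f1
  simp [f1, f2] at hne

theorem not_ricciGeneralizedPseudosymmetric {m : ℝ → ℝ} {U : Set (Fin 4 → ℝ)} {x : Fin 4 → ℝ}
    (hx : x ∈ U) (h : HasVaidyaCurvature m x) (hr : x 1 ≠ 0) (hs : Real.sin (x 2) ≠ 0)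
    (hm : m (x 0) ≠ 0) (hm' : deriv m (x 0) ≠ 0) :
    ¬ RicciGeneralizedPseudosymmetric (vaidya m) U := by
  rintro ⟨c₁, c₂, hc⟩
  obtain ⟨hne, h0⟩ := hc x hx
  have hRR : dot (vaidya m x) (riemann (vaidya m) x) (riemann (vaidya m) x) =
      tachibana (ricci (vaidya m) x) (riemann (vaidya m) x)
        + (m (x 0) / x 1 ^ 3) • tachibana (metric (vaidya m) x) (weyl (vaidya m) x) := by
    rw [← dot_riemann_riemann_sub h hr hs]; abel
  rw [dot_add, dot_smul, dot_smul, dot_wedgeTensor _ (isUnit_det_vaidya m hr hs), hRR] at h0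
  have hS : ∀ u v, tachibana (ricci (vaidya m) x) (riemann (vaidya m) x) ![2, 0, 1, 0] u v =
      tachibana ((2 * deriv m (x 0) / x 1 ^ 2 / 2) • symProd du du)
        (weylTensor (m (x 0)) (x 1) (Real.sin (x 2))) ![2, 0, 1, 0] u v := fun u v => by
    simp only [tachibana_eq_derivation, riemann_vaidya h, derivation_add, ricci_vaidya h,
      derivation_wedge_ricci_ricciPart, add_zero]
  have e1 := congrFun (congrFun (congrFun h0 ![2, 0, 1, 0]) 1) 2
  have e2 := congrFun (congrFun (congrFun h0 ![2, 0, 1, 0]) 0) 2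
  simp only [Pi.add_apply, Pi.smul_apply, Pi.zero_apply, smul_eq_mul, hS, metric_vaidya,
    weyl_vaidya h hr hs, tachibana_metric_weyl_rθ _ _ _ hr,
    tachibana_ricci_weyl_rθ, tachibana_metric_weyl_uθ,
    tachibana_ricci_weyl_uθ _ _ _ _ hr] at e1 e2
  have f1 : c₁ x = 0 := by
    have : c₁ x * (m (x 0) * m (x 0)) = 0 := by
      field_simp at e1
      linarith
    exact (mul_eq_zero.1 this).resolve_right (mul_ne_zero hm hm)
  have f2 : c₂ x = 0 := by
    rw [f1] at e2
    have : c₂ x * (m (x 0) * deriv m (x 0)) = 0 := by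
      field_simp at e2
      linarith
    exact (mul_eq_zero.1 this).resolve_right (mul_ne_zero hm hm')
  simp [f1, f2] at hne

/-- `R · C = C · C + (½ g ∧ S) · C`, with the value of `C · C` inserted. -/
theorem dot_riemann_weyl_apply {m : ℝ → ℝ} {x : Fin 4 → ℝ} (h : HasVaidyaCurvature m x)
    (hr : x 1 ≠ 0) (hs : Real.sin (x 2) ≠ 0) (I : Fin 4 → Fin 4) (u v : Fin 4) :
    dot (vaidya m x) (riemann (vaidya m) x) (weyl (vaidya m) x) I u v =
      m (x 0) / x 1 ^ 3 * tachibana (metricTensor (m (x 0)) (x 1) (Real.sin (x 2)))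
          (weylTensor (m (x 0)) (x 1) (Real.sin (x 2))) I u v
        - derivation (ricciPartMixed (2 * deriv m (x 0) / x 1 ^ 2) (m (x 0)) (x 1)
          (Real.sin (x 2)) u v) (weylTensor (m (x 0)) (x 1) (Real.sin (x 2))) I := by
  rw [dot_eq_derivation, raise_riemann_vaidya h hr hs, weyl_vaidya h hr hs, Pi.add_apply,
    Pi.add_apply, add_derivation, derivation_weylMixed_weylTensor, tachibana_eq_derivation]
  simp only [Pi.add_apply, Pi.smul_apply, smul_eq_mul]
  ring

theorem not_weylPseudosymmetric {m : ℝ → ℝ} {U : Set (Fin 4 → ℝ)} {x : Fin 4 → ℝ}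
    (hx : x ∈ U) (h : HasVaidyaCurvature m x) (hr : x 1 ≠ 0) (hs : Real.sin (x 2) ≠ 0)
    (hm : m (x 0) ≠ 0) (hm' : deriv m (x 0) ≠ 0) : ¬ WeylPseudosymmetric (vaidya m) U := by
  rintro ⟨c₁, c₂, hc⟩
  obtain ⟨hne, h0⟩ := hc x hx
  rw [dot_add, dot_smul, dot_smul, gaussian_eq,
    dot_wedgeTensor _ (isUnit_det_vaidya m hr hs)] at h0
  have e1 := congrFun (congrFun (congrFun h0 ![2, 0, 1, 0]) 1) 2
  have e2 := congrFun (congrFun (congrFun h0 ![2, 0, 1, 0]) 0) 2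
  simp only [Pi.add_apply, Pi.smul_apply, Pi.zero_apply, smul_eq_mul,
    dot_riemann_weyl_apply h hr hs] at e1 e2
  simp only [metric_vaidya, weyl_vaidya h hr hs, tachibana_metric_weyl_rθ _ _ _ hr,
    tachibana_metric_weyl_uθ, derivation_ricciPartMixed_weyl_rθ,
    derivation_ricciPartMixed_weyl_uθ _ _ _ _ hr] at e1 e2
  have f1 : c₁ x = 0 := by
    have : c₁ x * (m (x 0) * deriv m (x 0)) = 0 := by
      field_simp at e2
      linarith
    exact (mul_eq_zero.1 this).resolve_right (mul_ne_zero hm hm')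
  have f2 : c₂ x = 0 := by
    simpa [f1, hm, hr] using e1
  simp [f1, f2] at hne

theorem dot_riemann_weyl_ne_zero {m : ℝ → ℝ} {x : Fin 4 → ℝ} (h : HasVaidyaCurvature m x)
    (hr : x 1 ≠ 0) (hs : Real.sin (x 2) ≠ 0) (hm : m (x 0) ≠ 0) :
    dot (vaidya m x) (riemann (vaidya m) x) (weyl (vaidya m) x) ≠ 0 := by
  intro h0
  have e1 := congrFun (congrFun (congrFun h0 ![2, 0, 1, 0]) 1) 2
  rw [dot_riemann_weyl_apply h hr hs, tachibana_metric_weyl_rθ _ _ _ hr,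
    derivation_ricciPartMixed_weyl_rθ, Pi.zero_apply, Pi.zero_apply, Pi.zero_apply] at e1
  have : m (x 0) * m (x 0) = 0 := by
    field_simp at e1
    linarith
  exact mul_ne_zero hm hm this

/-- An open set of points on which the Vaidya metric with mass function `m` is regular and has
the Vaidya curvature. -/
structure IsVaidyaDomain (m : ℝ → ℝ) (U : Set (Fin 4 → ℝ)) : Prop where
  isOpen : IsOpen U
  differentiableAt : ∀ x ∈ U, DifferentiableAt ℝ m (x 0)
  differentiableAt_deriv : ∀ x ∈ U, DifferentiableAt ℝ (deriv m) (x 0)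
  r_ne_zero : ∀ x ∈ U, x 1 ≠ 0
  sin_ne_zero : ∀ x ∈ U, Real.sin (x 2) ≠ 0
  curvature : ∀ x ∈ U, HasVaidyaCurvature m x

/-! ### Derivatives of the Ricci and the Weyl tensor -/

theorem covDeriv_two {n : ℕ} (g : Metric n) (T : TensorField n 2) (x : Fin n → ℝ) (a i j : Fin n) :
    covDeriv g T x a ![i, j] = pd a (fun y => T y ![i, j]) x
      - ∑ p, (christoffel g x p a i * T x ![p, j] + christoffel g x p a j * T x ![i, p]) := by
  simp [covDeriv, Fin.sum_univ_two, update_vec_two_zero, update_vec_two_one,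
    Finset.sum_add_distrib]

theorem covDeriv_four {n : ℕ} (g : Metric n) (T : TensorField n 4) (x : Fin n → ℝ)
    (a i j k l : Fin n) :
    covDeriv g T x a ![i, j, k, l] = pd a (fun y => T y ![i, j, k, l]) x
      - ∑ p, (christoffel g x p a i * T x ![p, j, k, l] + christoffel g x p a j * T x ![i, p, k, l]
        + christoffel g x p a k * T x ![i, j, p, l]
        + christoffel g x p a l * T x ![i, j, k, p]) := by
  simp [covDeriv, Fin.sum_univ_four, update_vec_four_zero, update_vec_four_one,
    update_vec_four_two, update_vec_four_three, Finset.sum_add_distrib]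

theorem covDeriv_ricci_θ_θu {m : ℝ → ℝ} {U : Set (Fin 4 → ℝ)} (hV : IsVaidyaDomain m U)
    {x : Fin 4 → ℝ} (hx : x ∈ U) :
    covDeriv (vaidya m) (ricci (vaidya m)) x 2 ![2, 0] = -(2 * deriv m (x 0) / x 1) := by
  have hr := hV.r_ne_zero x hx
  rw [covDeriv_two, pd_congr hV.isOpen hx (f' := fun _ => 0)
    (fun y hy => by simp [ricci_vaidya (hV.curvature y hy), du]), pd_const]
  simp [Fin.sum_univ_four, ricci_vaidya (hV.curvature x hx), du, christoffelTable,
    christoffel_vaidya m (hV.differentiableAt x hx) hr (hV.sin_ne_zero x hx)]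
  field_simp
  ring

theorem covDeriv_ricci_u_θθ {m : ℝ → ℝ} {U : Set (Fin 4 → ℝ)} (hV : IsVaidyaDomain m U)
    {x : Fin 4 → ℝ} (hx : x ∈ U) :
    covDeriv (vaidya m) (ricci (vaidya m)) x 0 ![2, 2] = 0 := by
  rw [covDeriv_two, pd_congr hV.isOpen hx (f' := fun _ => 0)
    (fun y hy => by simp [ricci_vaidya (hV.curvature y hy), du]), pd_const]
  simp [ricci_vaidya (hV.curvature x hx), du, christoffelTable,
    christoffel_vaidya m (hV.differentiableAt x hx) (hV.r_ne_zero x hx) (hV.sin_ne_zero x hx)]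

theorem covDeriv_ricci_θ_uθ {m : ℝ → ℝ} {U : Set (Fin 4 → ℝ)} (hV : IsVaidyaDomain m U)
    {x : Fin 4 → ℝ} (hx : x ∈ U) :
    covDeriv (vaidya m) (ricci (vaidya m)) x 2 ![0, 2] = -(2 * deriv m (x 0) / x 1) := by
  have hr := hV.r_ne_zero x hx
  rw [covDeriv_two, pd_congr hV.isOpen hx (f' := fun _ => 0)
    (fun y hy => by simp [ricci_vaidya (hV.curvature y hy), du]), pd_const]
  simp [Fin.sum_univ_four, ricci_vaidya (hV.curvature x hx), du, christoffelTable,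
    christoffel_vaidya m (hV.differentiableAt x hx) hr (hV.sin_ne_zero x hx)]
  field_simp
  ring

theorem not_oneFormsRecurrentWith {m : ℝ → ℝ} {U : Set (Fin 4 → ℝ)} (hV : IsVaidyaDomain m U)
    {x : Fin 4 → ℝ} (hx : x ∈ U) (hm' : deriv m (x 0) ≠ 0) (Pi : (Fin 4 → ℝ) → Fin 4 → ℝ) :
    ¬ OneFormsRecurrentWith (vaidya m) U (ricci (vaidya m)) Pi := by
  intro h
  have hr := hV.r_ne_zero x hx
  -- `Π` drops out of the equation on `Λ_θ` and `(∂_θ, ∂_u)`, since `S(∂_θ, ·) = 0`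
  have e := h x hx 2 2 0
  simp only [frameDerivOne] at e
  rw [pd_congr hV.isOpen hx (f' := fun _ => 0)
    (fun y hy => by simp [ricci_vaidya (hV.curvature y hy), du]), pd_const,
    pd_congr hV.isOpen hx (f' := fun _ => 0)
    (fun y hy => by simp [ricci_vaidya (hV.curvature y hy), du]), pd_const] at e
  simp [Fin.sum_univ_four, ricci_vaidya (hV.curvature x hx), du, christoffelTable, hr, hm',
    christoffel_vaidya m (hV.differentiableAt x hx) hr (hV.sin_ne_zero x hx)] at e

/-- The component `C(∂_θ, ∂_r, ∂_u, ∂_r)` vanishes identically, but its covariant derivative in the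
direction of `∂_θ` does not. -/
theorem not_recurrentWith_weyl {m : ℝ → ℝ} {U : Set (Fin 4 → ℝ)} (hV : IsVaidyaDomain m U)
    {x : Fin 4 → ℝ} (hx : x ∈ U) (hm : m (x 0) ≠ 0) (Pi : (Fin 4 → ℝ) → Fin 4 → ℝ) :
    ¬ RecurrentWith (vaidya m) U (weyl (vaidya m)) Pi := by
  intro h
  have hr := hV.r_ne_zero x hx
  have hC : ∀ y ∈ U, weyl (vaidya m) y = weylTensor (m (y 0)) (y 1) (Real.sin (y 2)) :=
    fun y hy => weyl_vaidya (hV.curvature y hy) (hV.r_ne_zero y hy) (hV.sin_ne_zero y hy)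
  have e := h x hx 2 ![2, 1, 0, 1]
  rw [covDeriv_four, pd_congr hV.isOpen hx (f' := fun _ => 0)
    (fun y hy => by simp [hC y hy, weylTensor, radial, spherical]), pd_const] at e
  have : m (x 0) = 0 := by
    simp [Fin.sum_univ_four, hC x hx, weylTensor, radial, spherical, christoffelTable,
      christoffel_vaidya m (hV.differentiableAt x hx) hr (hV.sin_ne_zero x hx)] at e
    field_simp at e
    linarith
  exact hm this

/-! ### Compatible tensors -/

/-- The `(1,3)`-tensor `C + ½ g ∧ S + t ∧_S` with `S = σ du ⊗ du`, which is the Riemann tensor for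
`t = 0` and the projective tensor for `t = -1/3`, if `S` is the Ricci tensor, and the Weyl tensor
for `σ = 0`. -/
def curvatureFamily (t σ a r s : ℝ) (i j k p : Fin 4) : ℝ :=
  weylMixed a r s i j k p + ricciPartMixed σ a r s i j k p
    + t * (-wedgeEndo ((σ / 2) • symProd du du) i j k p)

theorem curvatureFamily_swap (t σ a r s : ℝ) (i j k p : Fin 4) :
    curvatureFamily t σ a r s j i k p = -curvatureFamily t σ a r s i j k p := by
  simp only [curvatureFamily, weylMixed, ricciPartMixed, wedgeEndo]
  ring

/-- The solutions of the compatibility equation do not depend on the coefficient `t` of `∧_S`, which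
is why the Riemann and the projective tensor have the same compatible tensors. -/
theorem compatible_curvatureFamily_iff (t σ : ℝ) {a r s : ℝ} (ha : a ≠ 0) (hr : r ≠ 0)
    (hs : s ≠ 0) (A : Matrix (Fin 4) (Fin 4) ℝ) :
    (∀ i j k l, ∑ q, (A i q * curvatureFamily t σ a r s k l j q
      + A k q * curvatureFamily t σ a r s l i j q
      + A l q * curvatureFamily t σ a r s i k j q) = 0) ↔
    A = !![A 0 0, A 0 1, 0, 0; A 0 1 + σ * r ^ 3 / (2 * a) * A 1 1, A 1 1, 0, 0;
      0, 0, A 2 2, A 3 2; 0, 0, A 3 2, A 3 3] := by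
  constructor
  · intro h
    -- two independent equations for each of the pairs `(A 1 2, A 2 1)` and `(A 1 3, A 3 1)`
    have e1 : -(a / r ^ 3) * (A 1 2 + 2 * A 2 1) = 0 := by
      rw [← h 0 1 1 2]
      simp [Fin.sum_univ_four, curvatureFamily, weylMixed, ricciPartMixed, wedgeEndo, radial,
        spherical, radialProj, sphericalProj, du, gradU]
      ring
    have e2 : -(a / r ^ 3) * (A 1 3 + 2 * A 3 1) = 0 := by
      rw [← h 0 1 1 3]
      simp [Fin.sum_univ_four, curvatureFamily, weylMixed, ricciPartMixed, wedgeEndo, radial,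
        spherical, radialProj, sphericalProj, du, gradU]
      ring
    have e3 : -(a / r ^ 3) * (r ^ 2 * s ^ 2) * (2 * A 1 2 + A 2 1) = 0 := by
      rw [← h 1 3 2 3]
      simp [Fin.sum_univ_four, curvatureFamily, weylMixed, ricciPartMixed, wedgeEndo, radial,
        spherical, radialProj, sphericalProj, du, gradU]
      ring
    have e4 : a / r ^ 3 * r ^ 2 * (2 * A 1 3 + A 3 1) = 0 := by
      rw [← h 1 2 2 3]
      simp [Fin.sum_univ_four, curvatureFamily, weylMixed, ricciPartMixed, wedgeEndo, radial,
        spherical, radialProj, sphericalProj, du, gradU]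
      ring
    have hc : a / r ^ 3 ≠ 0 := div_ne_zero ha (pow_ne_zero 3 hr)
    have hr2 : r ^ 2 ≠ 0 := pow_ne_zero 2 hr
    have hs2 : s ^ 2 ≠ 0 := pow_ne_zero 2 hs
    simp only [mul_eq_zero, neg_eq_zero, hc, hr2, hs2, false_or] at e1 e2 e3 e4
    have z12 : A 1 2 = 0 := by linarith
    have z21 : A 2 1 = 0 := by linarith
    have z13 : A 1 3 = 0 := by linarith
    have z31 : A 3 1 = 0 := by linarith
    -- once these entries vanish, the same for the pairs `(A 0 2, A 2 0)` and `(A 0 3, A 3 0)`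
    have e5 : a / r ^ 3 * (A 0 2 + 2 * A 2 0) = 0 := by
      rw [← h 0 0 1 2]
      simp [Fin.sum_univ_four, curvatureFamily, weylMixed, ricciPartMixed, wedgeEndo, radial,
        spherical, radialProj, sphericalProj, du, gradU, z12, z21]
      ring
    have e6 : a / r ^ 3 * (A 0 3 + 2 * A 3 0) = 0 := by
      rw [← h 0 0 1 3]
      simp [Fin.sum_univ_four, curvatureFamily, weylMixed, ricciPartMixed, wedgeEndo, radial,
        spherical, radialProj, sphericalProj, du, gradU, z13, z31]
      ring
    have e7 : -(a / r ^ 3) * (r ^ 2 * s ^ 2) * (2 * A 0 2 + A 2 0) = 0 := by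
      rw [← h 0 3 2 3]
      simp [Fin.sum_univ_four, curvatureFamily, weylMixed, ricciPartMixed, wedgeEndo, radial,
        spherical, radialProj, sphericalProj, du, gradU, z21]
      ring
    have e8 : a / r ^ 3 * r ^ 2 * (2 * A 0 3 + A 3 0) = 0 := by
      rw [← h 0 2 2 3]
      simp [Fin.sum_univ_four, curvatureFamily, weylMixed, ricciPartMixed, wedgeEndo, radial,
        spherical, radialProj, sphericalProj, du, gradU, z31]
      ring
    have e9 : a / r ^ 3 * (A 2 3 - A 3 2) = 0 := by
      rw [← neg_eq_zero, ← h 0 1 2 3]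
      simp [Fin.sum_univ_four, curvatureFamily, weylMixed, ricciPartMixed, wedgeEndo, radial,
        spherical, radialProj, sphericalProj, du, gradU]
      ring
    have e10 : a / r ^ 3 * r ^ 2 * (A 1 0 - (A 0 1 + σ * r ^ 3 / (2 * a) * A 1 1)) = 0 := by
      rw [← neg_eq_zero, ← h 0 2 1 2]
      simp [Fin.sum_univ_four, curvatureFamily, weylMixed, ricciPartMixed, wedgeEndo, radial,
        spherical, radialProj, sphericalProj, du, gradU]
      field_simp
      ring
    simp only [mul_eq_zero, neg_eq_zero, hc, hr2, hs2, false_or] at e5 e6 e7 e8 e9 e10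
    have z02 : A 0 2 = 0 := by linarith
    have z20 : A 2 0 = 0 := by linarith
    have z03 : A 0 3 = 0 := by linarith
    have z30 : A 3 0 = 0 := by linarith
    ext i j
    fin_cases i <;> fin_cases j <;>
      simp [z02, z20, z03, z30, z12, z21, z13, z31, sub_eq_zero.1 e9, sub_eq_zero.1 e10]
  · intro hA i j k l
    refine alternating_fin_four (F := fun i k l =>
      ∑ q, (A i q * curvatureFamily t σ a r s k l j q + A k q * curvatureFamily t σ a r s l i j q
      + A l q * curvatureFamily t σ a r s i k j q)) (fun i k l => ?_) (fun i k l => ?_) ?_ ?_ ?_ ?_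
      i k l
    · exact Finset.sum_congr rfl fun q _ => by ring
    · rw [← Finset.sum_neg_distrib]
      refine Finset.sum_congr rfl fun q _ => ?_
      rw [curvatureFamily_swap t σ a r s k l, curvatureFamily_swap t σ a r s i k,
        curvatureFamily_swap t σ a r s l i]
      ring
    all_goals
      generalize A 0 0 = a₁₁, A 0 1 = a₁₂, A 1 1 = a₂₂, A 2 2 = a₃₃, A 3 2 = a₄₃,
        A 3 3 = a₄₄ at hA
      subst hA
      fin_cases j <;>
        simp [Fin.sum_univ_four, curvatureFamily, weylMixed, ricciPartMixed, wedgeEndo, radial,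
          spherical, radialProj, sphericalProj, du, gradU] <;> field_simp <;> ring

/-! ### Curvature 2-forms -/

/-- The derivative of `weylMixed` along a path with velocity `(a', r', s')`. -/
def weylMixedDeriv (a r s a' r' s' : ℝ) (i j k p : Fin 4) : ℝ :=
  (-(a' / r ^ 3) + 3 * a * r' / r ^ 4) *
    (2 * (radial a r j k * radialProj i p - radial a r i k * radialProj j p)
      + 2 * (spherical r s j k * sphericalProj i p - spherical r s i k * sphericalProj j p)
      - (radial a r j k * sphericalProj i p + spherical r s j k * radialProj i p
        - radial a r i k * sphericalProj j p - spherical r s i k * radialProj j p))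
  + -(a / r ^ 3) *
    (2 * (radialDeriv a r a' r' j k * radialProj i p - radialDeriv a r a' r' i k * radialProj j p)
      + 2 * (sphericalDeriv r s r' s' j k * sphericalProj i p
        - sphericalDeriv r s r' s' i k * sphericalProj j p)
      - (radialDeriv a r a' r' j k * sphericalProj i p
        + sphericalDeriv r s r' s' j k * radialProj i p
        - radialDeriv a r a' r' i k * sphericalProj j p
        - sphericalDeriv r s r' s' i k * radialProj j p))

/-- The derivative of `ricciPartMixed` along a path with velocity `(σ', a', r', s')`. -/
def ricciPartMixedDeriv (σ a r s σ' a' r' s' : ℝ) (i j k p : Fin 4) : ℝ :=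
  σ' / 2 * (du j * du k * (radialProj i p + sphericalProj i p)
    + (radial a r j k + spherical r s j k) * (du i * gradU p)
    - du i * du k * (radialProj j p + sphericalProj j p)
    - (radial a r i k + spherical r s i k) * (du j * gradU p))
  + σ / 2 * ((radialDeriv a r a' r' j k + sphericalDeriv r s r' s' j k) * (du i * gradU p)
    - (radialDeriv a r a' r' i k + sphericalDeriv r s r' s' i k) * (du j * gradU p))

theorem hasDerivAt_weylMixed {a r s : ℝ → ℝ} {a' r' s' t : ℝ} (ha : HasDerivAt a a' t)
    (hr : HasDerivAt r r' t) (hs : HasDerivAt s s' t) (hr0 : r t ≠ 0) (i j k p : Fin 4) :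
    HasDerivAt (fun τ => weylMixed (a τ) (r τ) (s τ) i j k p)
      (weylMixedDeriv (a t) (r t) (s t) a' r' s' i j k p) t := by
  have h := fun i j => hasDerivAt_radial ha hr hr0 i j
  have h' := fun i j => hasDerivAt_spherical hr hs i j
  have hc : HasDerivAt (fun τ => -(a τ / r τ ^ 3)) (-(a' / r t ^ 3) + 3 * a t * r' / r t ^ 4) t :=
    (ha.fun_div (hr.fun_pow 3) (pow_ne_zero 3 hr0)).fun_neg.congr_deriv (by field_simp; ring)
  exact hc.fun_mul ((((((h j k).mul_const _).fun_sub ((h i k).mul_const _)).const_mul 2).fun_add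
    ((((h' j k).mul_const _).fun_sub ((h' i k).mul_const _)).const_mul 2)).fun_sub
    (((((h j k).mul_const _).fun_add ((h' j k).mul_const _)).fun_sub
      ((h i k).mul_const _)).fun_sub ((h' i k).mul_const _)))

theorem hasDerivAt_ricciPartMixed {σ a r s : ℝ → ℝ} {σ' a' r' s' t : ℝ} (hσ : HasDerivAt σ σ' t)
    (ha : HasDerivAt a a' t) (hr : HasDerivAt r r' t) (hs : HasDerivAt s s' t) (hr0 : r t ≠ 0)
    (i j k p : Fin 4) :
    HasDerivAt (fun τ => ricciPartMixed (σ τ) (a τ) (r τ) (s τ) i j k p)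
      (ricciPartMixedDeriv (σ t) (a t) (r t) (s t) σ' a' r' s' i j k p) t := by
  have h := fun i j => (hasDerivAt_radial ha hr hr0 i j).fun_add (hasDerivAt_spherical hr hs i j)
  exact (hσ.div_const 2).fun_mul
    ((((h j k).mul_const _).const_add _ |>.sub_const _).fun_sub ((h i k).mul_const _))

theorem pd_weylMixed {m : ℝ → ℝ} {x : Fin 4 → ℝ} (hm : DifferentiableAt ℝ m (x 0)) (hr : x 1 ≠ 0)
    (i j k l p : Fin 4) :
    pd i (fun y => weylMixed (m (y 0)) (y 1) (Real.sin (y 2)) j k l p) x =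
      weylMixedDeriv (m (x 0)) (x 1) (Real.sin (x 2)) (deriv m (x 0) * if i = 0 then 1 else 0)
        (if i = 1 then 1 else 0) (Real.cos (x 2) * if i = 2 then 1 else 0) j k l p := by
  have e : ∀ k, Function.update x i (x i) k = x k := fun k => by rw [Function.update_eq_self]
  have h0 : HasDerivAt (fun t => m (Function.update x i t 0))
      (deriv m (x 0) * if i = 0 then 1 else 0) (x i) := hasDerivAt_comp_coord hm i
  have := hasDerivAt_weylMixed h0 (hasDerivAt_coord x i 1) (hasDerivAt_coord x i 2).sin
    (by rwa [e]) j k l p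
  simp only [e] at this
  exact this.deriv

theorem pd_riemannMixed {m : ℝ → ℝ} {x : Fin 4 → ℝ} (hm : DifferentiableAt ℝ m (x 0))
    (hm' : DifferentiableAt ℝ (deriv m) (x 0)) (hr : x 1 ≠ 0) (i j k l p : Fin 4) :
    pd i (fun y => weylMixed (m (y 0)) (y 1) (Real.sin (y 2)) j k l p
        + ricciPartMixed (2 * deriv m (y 0) / y 1 ^ 2) (m (y 0)) (y 1) (Real.sin (y 2)) j k l p) x =
      weylMixedDeriv (m (x 0)) (x 1) (Real.sin (x 2)) (deriv m (x 0) * if i = 0 then 1 else 0)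
        (if i = 1 then 1 else 0) (Real.cos (x 2) * if i = 2 then 1 else 0) j k l p
      + ricciPartMixedDeriv (2 * deriv m (x 0) / x 1 ^ 2) (m (x 0)) (x 1) (Real.sin (x 2))
        (2 * (deriv (deriv m) (x 0) * if i = 0 then 1 else 0) / x 1 ^ 2
          - 4 * deriv m (x 0) * (if i = 1 then 1 else 0) / x 1 ^ 3)
        (deriv m (x 0) * if i = 0 then 1 else 0)
        (if i = 1 then 1 else 0) (Real.cos (x 2) * if i = 2 then 1 else 0) j k l p := by
  have e : ∀ k, Function.update x i (x i) k = x k := fun k => by rw [Function.update_eq_self]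
  have h0 : ∀ f : ℝ → ℝ, DifferentiableAt ℝ f (x 0) →
      HasDerivAt (fun t => f (Function.update x i t 0))
        (deriv f (x 0) * if i = 0 then 1 else 0) (x i) := fun f hf => hasDerivAt_comp_coord hf i
  have hr' : Function.update x i (x i) 1 ≠ 0 := by rwa [e]
  have h1 := hasDerivAt_coord x i 1
  have h2 := (hasDerivAt_coord x i 2).sin
  have hσ : HasDerivAt
      (fun t => 2 * deriv m (Function.update x i t 0) / Function.update x i t 1 ^ 2)
      (2 * (deriv (deriv m) (x 0) * if i = 0 then 1 else 0) / x 1 ^ 2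
          - 4 * deriv m (x 0) * (if i = 1 then 1 else 0) / x 1 ^ 3) (x i) := by
    refine (((h0 _ hm').const_mul 2).fun_div (h1.fun_pow 2) (pow_ne_zero 2 hr')).congr_deriv ?_
    simp only [e]
    field_simp
    ring
  have := (hasDerivAt_weylMixed (h0 m hm) h1 h2 hr' j k l p).fun_add
    (hasDerivAt_ricciPartMixed hσ (h0 m hm) h1 h2 hr' j k l p)
  simp only [e] at this
  exact this.deriv

theorem extCovDeriv_cycle {n : ℕ} (g : Metric n)
    (Ω : Fin n → Fin n → (Fin n → ℝ) → Fin n → Fin n → ℝ) (l m : Fin n) (x : Fin n → ℝ)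
    (i j k : Fin n) : extCovDeriv g Ω l m x i j k = extCovDeriv g Ω l m x j k i := by
  simp only [extCovDeriv]; ring

theorem extCovDeriv_swap {n : ℕ} (g : Metric n)
    {Ω : Fin n → Fin n → (Fin n → ℝ) → Fin n → Fin n → ℝ}
    (hΩ : ∀ l m x j k, Ω l m x k j = -Ω l m x j k) (l m : Fin n) (x : Fin n → ℝ)
    (i j k : Fin n) : extCovDeriv g Ω l m x i k j = -extCovDeriv g Ω l m x i j k := by
  have h : ∀ i j k, frameDeriv g Ω l m x i k j = -frameDeriv g Ω l m x i j k := fun i j k => by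
    have h1 : pd i (fun y => -Ω l m y j k) x = -pd i (fun y => Ω l m y j k) x := by
      simp only [pd, deriv.fun_neg]
    simp only [frameDeriv, hΩ _ _ _ j k, h1, neg_add, ← Finset.sum_neg_distrib]
    congr 1
    exact Finset.sum_congr rfl fun p _ => by ring
  simp only [extCovDeriv, h i j k, h j k i, h k i j]
  ring

theorem curvForm_weyl {m : ℝ → ℝ} {U : Set (Fin 4 → ℝ)} (hV : IsVaidyaDomain m U)
    {x : Fin 4 → ℝ} (hx : x ∈ U) (l p j k : Fin 4) :
    curvForm (vaidya m) (weyl (vaidya m)) l p x j k =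
      weylMixed (m (x 0)) (x 1) (Real.sin (x 2)) j k l p := by
  rw [curvForm, raise_weyl_vaidya (hV.curvature x hx) (hV.r_ne_zero x hx) (hV.sin_ne_zero x hx)]

theorem curvForm_riemann {m : ℝ → ℝ} {U : Set (Fin 4 → ℝ)} (hV : IsVaidyaDomain m U)
    {x : Fin 4 → ℝ} (hx : x ∈ U) (l p j k : Fin 4) :
    curvForm (vaidya m) (riemann (vaidya m)) l p x j k =
      weylMixed (m (x 0)) (x 1) (Real.sin (x 2)) j k l p
        + ricciPartMixed (2 * deriv m (x 0) / x 1 ^ 2) (m (x 0)) (x 1) (Real.sin (x 2))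
          j k l p := by
  rw [curvForm, raise_riemann_vaidya (hV.curvature x hx) (hV.r_ne_zero x hx)
    (hV.sin_ne_zero x hx)]
  rfl

set_option maxHeartbeats 1000000 in
theorem curvFormsRecurrentWith_weyl {m : ℝ → ℝ} {U : Set (Fin 4 → ℝ)} (hV : IsVaidyaDomain m U)
    (hm0 : ∀ x ∈ U, m (x 0) ≠ 0) :
    CurvFormsRecurrentWith (vaidya m) U (weyl (vaidya m))
      (fun x => ![deriv m (x 0) / m (x 0), 0, 0, 0]) := by
  intro x hx l p i j k
  have hm := hm0 x hx
  have hr := hV.r_ne_zero x hx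
  have hs := hV.sin_ne_zero x hx
  have hd := hV.differentiableAt x hx
  have hsk : ∀ l p (x : Fin 4 → ℝ) j k, weylMixed (m (x 0)) (x 1) (Real.sin (x 2)) k j l p =
      -weylMixed (m (x 0)) (x 1) (Real.sin (x 2)) j k l p := fun l p x j k => by
    simp only [weylMixed]; ring
  have hF : ∀ i j k, frameDeriv (vaidya m) (curvForm (vaidya m) (weyl (vaidya m))) l p x i j k =
      frameDeriv (vaidya m) (fun l p (x : Fin 4 → ℝ) j k =>
        weylMixed (m (x 0)) (x 1) (Real.sin (x 2)) j k l p)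
        l p x i j k := fun i j k => by
    simp only [frameDeriv, curvForm_weyl hV hx]
    rw [pd_congr hV.isOpen hx (fun y hy => curvForm_weyl hV hy l p j k)]
  have hE : ∀ i j k, extCovDeriv (vaidya m) (curvForm (vaidya m) (weyl (vaidya m))) l p x i j k =
      extCovDeriv (vaidya m) (fun l p (x : Fin 4 → ℝ) j k =>
        weylMixed (m (x 0)) (x 1) (Real.sin (x 2)) j k l p)
        l p x i j k := fun i j k => by
    simp only [extCovDeriv, hF]
  simp only [hE, curvForm_weyl hV hx]
  rw [← sub_eq_zero]
  refine alternating_fin_four (F := fun i j k => extCovDeriv (vaidya m)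
    (fun l p (x : Fin 4 → ℝ) j k => weylMixed (m (x 0)) (x 1) (Real.sin (x 2)) j k l p) l p x i j k
    - (![deriv m (x 0) / m (x 0), 0, 0, 0] i * weylMixed (m (x 0)) (x 1) (Real.sin (x 2)) j k l p
      + ![deriv m (x 0) / m (x 0), 0, 0, 0] j * weylMixed (m (x 0)) (x 1) (Real.sin (x 2)) k i l p
      + ![deriv m (x 0) / m (x 0), 0, 0, 0] k * weylMixed (m (x 0)) (x 1) (Real.sin (x 2)) i j l p))
    (fun i j k => ?_) (fun i j k => ?_) ?_ ?_ ?_ ?_ i j k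
  · rw [extCovDeriv_cycle]; ring
  · rw [extCovDeriv_swap _ hsk, hsk _ _ x j k, hsk _ _ x i j, hsk _ _ x k i]; ring
  all_goals
    simp only [extCovDeriv, frameDeriv, pd_weylMixed hd hr, christoffel_vaidya m hd hr hs,
      Fin.sum_univ_four]
    generalize Real.sin (x 2) = s at *
    generalize Real.cos (x 2) = c at *
    generalize x 1 = r at *
    generalize m (x 0) = a at *
    generalize deriv m (x 0) = b at *
    fin_cases l <;> fin_cases p <;>
      simp [christoffelTable, weylMixed, weylMixedDeriv, radial, spherical, radialDeriv,
        sphericalDeriv, radialProj, sphericalProj] <;> field_simp <;> ring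

/-- The instances of the second Bianchi identity for the curvature 2-forms `Ω_φ^θ` and `Ω_r^r`. -/
theorem extCovDeriv_riemann {m : ℝ → ℝ} {U : Set (Fin 4 → ℝ)} (hV : IsVaidyaDomain m U)
    {x : Fin 4 → ℝ} (hx : x ∈ U) :
    extCovDeriv (vaidya m) (curvForm (vaidya m) (riemann (vaidya m))) 3 2 x 0 2 3 = 0 ∧
    extCovDeriv (vaidya m) (curvForm (vaidya m) (riemann (vaidya m))) 3 2 x 1 2 3 = 0 ∧
    extCovDeriv (vaidya m) (curvForm (vaidya m) (riemann (vaidya m))) 1 1 x 2 0 1 = 0 ∧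
    extCovDeriv (vaidya m) (curvForm (vaidya m) (riemann (vaidya m))) 1 1 x 3 0 1 = 0 := by
  have hr := hV.r_ne_zero x hx
  have hs := hV.sin_ne_zero x hx
  have hd := hV.differentiableAt x hx
  have hd' := hV.differentiableAt_deriv x hx
  have hF : ∀ l p i j k,
      frameDeriv (vaidya m) (curvForm (vaidya m) (riemann (vaidya m))) l p x i j k =
      frameDeriv (vaidya m) (fun l p (x : Fin 4 → ℝ) j k =>
        weylMixed (m (x 0)) (x 1) (Real.sin (x 2)) j k l p
        + ricciPartMixed (2 * deriv m (x 0) / x 1 ^ 2) (m (x 0)) (x 1) (Real.sin (x 2)) j k l p)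
        l p x i j k := fun l p i j k => by
    simp only [frameDeriv, curvForm_riemann hV hx]
    rw [pd_congr hV.isOpen hx (fun y hy => curvForm_riemann hV hy l p j k)]
  simp only [extCovDeriv, hF]
  simp only [frameDeriv, pd_riemannMixed hd hd' hr, christoffel_vaidya m hd hr hs,
    Fin.sum_univ_four]
  generalize Real.sin (x 2) = s at *
  generalize Real.cos (x 2) = c at *
  generalize x 1 = r at *
  generalize m (x 0) = a at *
  generalize deriv m (x 0) = b at *
  refine ⟨?_, ?_, ?_, ?_⟩ <;>
    simp [christoffelTable, weylMixed, weylMixedDeriv, ricciPartMixed, ricciPartMixedDeriv, radial,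
      spherical, radialDeriv, sphericalDeriv, radialProj, sphericalProj, du, gradU] <;>
    field_simp <;> ring

theorem not_curvFormsRecurrent_riemann {m : ℝ → ℝ} {U : Set (Fin 4 → ℝ)}
    (hV : IsVaidyaDomain m U) (hm0 : ∀ x ∈ U, m (x 0) ≠ 0) :
    ¬ CurvFormsRecurrent (vaidya m) U (riemann (vaidya m)) := by
  rintro ⟨Pi, ⟨x, hx, hPi⟩, h⟩
  -- in each of the four Bianchi identities a single component of `Π` survives in `Π ∧ Ω`
  have hm := hm0 x hx
  have hr := hV.r_ne_zero x hx
  have hs := hV.sin_ne_zero x hx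
  obtain ⟨b0, b1, b2, b3⟩ := extCovDeriv_riemann hV hx
  rw [h x hx] at b0 b1 b2 b3
  simp [curvForm_riemann hV hx, weylMixed, ricciPartMixed, radial, spherical, radialProj,
    sphericalProj, du, gradU, hm, hr, hs] at b0 b1 b2 b3
  refine hPi (funext fun i => ?_)
  fin_cases i <;> simp [b0, b1, b2, b3]

/-! ### Compatibility with the curvature tensors of the Vaidya metric -/

theorem weylTensor_skew (a r s : ℝ) (i j k l : Fin 4) :
    weylTensor a r s ![i, j, k, l] = -weylTensor a r s ![j, i, k, l] := by
  simp only [weylTensor, Pi.smul_apply, Pi.add_apply, Pi.sub_apply, kulkarniNomizu_apply,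
    ofMatrix_apply, smul_eq_mul]
  ring

theorem weylTensor_pair (a r s : ℝ) (i j k l : Fin 4) :
    weylTensor a r s ![i, j, k, l] = weylTensor a r s ![k, l, i, j] := by
  simp only [weylTensor, Pi.smul_apply, Pi.add_apply, Pi.sub_apply, kulkarniNomizu_apply,
    ofMatrix_apply, smul_eq_mul]
  rw [radial_comm a r k j, radial_comm a r l i, radial_comm a r k i, radial_comm a r l j,
    spherical_comm r s k j, spherical_comm r s l i, spherical_comm r s k i, spherical_comm r s l j]
  ring

theorem ricciPart_skew (σ a r s : ℝ) (i j k l : Fin 4) :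
    ricciPart σ a r s ![i, j, k, l] = -ricciPart σ a r s ![j, i, k, l] := by
  simp only [ricciPart, Pi.smul_apply, Pi.add_apply, kulkarniNomizu_apply, ofMatrix_apply,
    symProd_apply, smul_eq_mul]
  ring

theorem ricciPart_pair (σ a r s : ℝ) (i j k l : Fin 4) :
    ricciPart σ a r s ![i, j, k, l] = ricciPart σ a r s ![k, l, i, j] := by
  simp only [ricciPart, Pi.smul_apply, Pi.add_apply, kulkarniNomizu_apply, ofMatrix_apply,
    symProd_apply, smul_eq_mul]
  rw [radial_comm a r k j, radial_comm a r l i, radial_comm a r k i, radial_comm a r l j,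
    spherical_comm r s k j, spherical_comm r s l i, spherical_comm r s k i, spherical_comm r s l j]
  ring

theorem isCompatible_riemann_iff_last {m : ℝ → ℝ} {x : Fin 4 → ℝ} (h : HasVaidyaCurvature m x)
    (E : Tensor 4 2) : IsCompatible (vaidya m x) (riemann (vaidya m) x) E ↔
      IsCompatibleLast (vaidya m x) (riemann (vaidya m) x) E := by
  refine isCompatible_iff_last _ _ _ (fun i j k l => ?_) (fun i j k l => ?_)
  · rw [riemann_vaidya h, Pi.add_apply, Pi.add_apply, weylTensor_skew, ricciPart_skew]; ring
  · rw [riemann_vaidya h, Pi.add_apply, Pi.add_apply, weylTensor_pair, ricciPart_pair]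

theorem isCompatible_weyl_iff_last {m : ℝ → ℝ} {x : Fin 4 → ℝ} (h : HasVaidyaCurvature m x)
    (hr : x 1 ≠ 0) (hs : Real.sin (x 2) ≠ 0) (E : Tensor 4 2) :
    IsCompatible (vaidya m x) (weyl (vaidya m) x) E ↔
      IsCompatibleLast (vaidya m x) (weyl (vaidya m) x) E := by
  rw [weyl_vaidya h hr hs]
  exact isCompatible_iff_last _ _ _ (weylTensor_skew _ _ _) (weylTensor_pair _ _ _)

theorem isCompatible_riemann_iff {m : ℝ → ℝ} {x : Fin 4 → ℝ} (h : HasVaidyaCurvature m x)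
    (hr : x 1 ≠ 0) (hs : Real.sin (x 2) ≠ 0) (hm : m (x 0) ≠ 0) (A : Matrix (Fin 4) (Fin 4) ℝ) :
    IsCompatible (vaidya m x) (riemann (vaidya m) x) (ofMatrix A) ↔
      A = !![A 0 0, A 0 1, 0, 0; A 0 1 + x 1 * deriv m (x 0) / m (x 0) * A 1 1, A 1 1, 0, 0;
        0, 0, A 2 2, A 3 2; 0, 0, A 3 2, A 3 3] := by
  have e : x 1 * deriv m (x 0) / m (x 0) =
      2 * deriv m (x 0) / x 1 ^ 2 * x 1 ^ 3 / (2 * m (x 0)) := by field_simp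
  rw [e, isCompatible_riemann_iff_last h, isCompatibleLast_iff_raise _ (vaidya_isSymm m x),
    raise_riemann_vaidya h hr hs, ← compatible_curvatureFamily_iff 0 _ hm hr hs A]
  simp only [curvatureFamily, Pi.add_apply, ofMatrix_apply, zero_mul, add_zero]

theorem isCompatibleLast_projective_iff {m : ℝ → ℝ} {x : Fin 4 → ℝ} (h : HasVaidyaCurvature m x)
    (hr : x 1 ≠ 0) (hs : Real.sin (x 2) ≠ 0) (hm : m (x 0) ≠ 0) (A : Matrix (Fin 4) (Fin 4) ℝ) :
    IsCompatibleLast (vaidya m x) (projective (vaidya m) x) (ofMatrix A) ↔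
      A = !![A 0 0, A 0 1, 0, 0; A 0 1 + x 1 * deriv m (x 0) / m (x 0) * A 1 1, A 1 1, 0, 0;
        0, 0, A 2 2, A 3 2; 0, 0, A 3 2, A 3 3] := by
  have e : x 1 * deriv m (x 0) / m (x 0) =
      2 * deriv m (x 0) / x 1 ^ 2 * x 1 ^ 3 / (2 * m (x 0)) := by field_simp
  have hP : raise (vaidya m x) (projective (vaidya m) x) =
      curvatureFamily (-(1 / ((4 : ℕ) - 1 : ℝ))) (2 * deriv m (x 0) / x 1 ^ 2) (m (x 0)) (x 1)
        (Real.sin (x 2)) := by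
    ext i j k p
    rw [projective, raise_sub, raise_smul, raise_riemann_vaidya h hr hs, ricci_vaidya h]
    simp only [Pi.sub_apply, Pi.smul_apply, raise_wedgeTensor _ (isUnit_det_vaidya m hr hs),
      curvatureFamily, Pi.add_apply, Pi.neg_apply, smul_eq_mul]
    ring
  rw [e, isCompatibleLast_iff_raise _ (vaidya_isSymm m x), hP,
    ← compatible_curvatureFamily_iff _ _ hm hr hs A]
  rfl

theorem isCompatible_weyl_iff {m : ℝ → ℝ} {x : Fin 4 → ℝ} (h : HasVaidyaCurvature m x)
    (hr : x 1 ≠ 0) (hs : Real.sin (x 2) ≠ 0) (hm : m (x 0) ≠ 0) (A : Matrix (Fin 4) (Fin 4) ℝ) :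
    IsCompatible (vaidya m x) (weyl (vaidya m) x) (ofMatrix A) ↔
      A = !![A 0 0, A 0 1, 0, 0; A 0 1, A 1 1, 0, 0; 0, 0, A 2 2, A 3 2; 0, 0, A 3 2, A 3 3] := by
  have hC : curvatureFamily 0 0 (m (x 0)) (x 1) (Real.sin (x 2)) =
      weylMixed (m (x 0)) (x 1) (Real.sin (x 2)) := by
    ext i j k p
    simp only [curvatureFamily, ricciPartMixed]
    ring
  have key := compatible_curvatureFamily_iff 0 0 hm hr hs A
  rw [hC] at key
  rw [isCompatible_weyl_iff_last h hr hs, isCompatibleLast_iff_raise _ (vaidya_isSymm m x),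
    raise_weyl_vaidya h hr hs]
  simp only [zero_mul, zero_div, add_zero] at key
  exact key

/-- At points with `m ≠ 0` this is a case of the classification of the compatible tensors; the
computation also covers the zeros of `m`. -/
theorem isCompatible_ricci {m : ℝ → ℝ} {x : Fin 4 → ℝ} (h : HasVaidyaCurvature m x)
    (hr : x 1 ≠ 0) (hs : Real.sin (x 2) ≠ 0) :
    IsCompatible (vaidya m x) (riemann (vaidya m) x) (ricci (vaidya m) x) ∧
      IsCompatible (vaidya m x) (weyl (vaidya m) x) (ricci (vaidya m) x) := by
  rw [isCompatible_riemann_iff_last h, isCompatible_weyl_iff_last h hr hs,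
    isCompatibleLast_iff_raise _ (vaidya_isSymm m x),
    isCompatibleLast_iff_raise _ (vaidya_isSymm m x),
    raise_riemann_vaidya h hr hs, raise_weyl_vaidya h hr hs, ricci_vaidya h]
  have key : ∀ (σ : ℝ) (B : Fin 4 → Fin 4 → Fin 4 → Fin 4 → ℝ) (i j k l : Fin 4),
      ∑ q, ((σ • symProd du du) ![i, q] * B k l j q + (σ • symProd du du) ![k, q] * B l i j q
        + (σ • symProd du du) ![l, q] * B i k j q) =
      2 * σ * (du i * (∑ q, B k l j q * du q) + du k * (∑ q, B l i j q * du q)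
        + du l * (∑ q, B i k j q * du q)) := fun σ B i j k l => by
    simp only [Fin.sum_univ_four, Pi.smul_apply, symProd_apply, smul_eq_mul]
    ring
  refine ⟨fun i j k l => ?_, fun i j k l => ?_⟩ <;> rw [key] <;>
    simp only [Pi.add_apply, add_mul, Finset.sum_add_distrib, sum_weylMixed_mul,
      sum_ricciPartMixed_mul, radialProj_du, sphericalProj_du, gradU_du] <;> ring

/-! ### Points where neither the mass nor its derivative vanishes -/

theorem isVaidyaDomain {m : ℝ → ℝ} {I : Set ℝ} (hI : IsOpen I) (hm : ContDiffOn ℝ ∞ m I)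
    {U : Set (Fin 4 → ℝ)} (hU : IsOpen U)
    (hdom : ∀ x ∈ U, x 0 ∈ I ∧ 0 < x 1 ∧ 0 < x 2 ∧ x 2 < Real.pi) : IsVaidyaDomain m U where
  isOpen := hU
  differentiableAt x hx :=
    (hm.contDiffAt (hI.mem_nhds (hdom x hx).1)).differentiableAt (by simp)
  differentiableAt_deriv x hx :=
    ((hm.deriv_of_isOpen (m := 1) hI (by norm_cast)).contDiffAt
      (hI.mem_nhds (hdom x hx).1)).differentiableAt (by simp)
  r_ne_zero x hx := (hdom x hx).2.1.ne'
  sin_ne_zero x hx := (Real.sin_pos_of_pos_of_lt_pi (hdom x hx).2.2.1 (hdom x hx).2.2.2).ne'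
  curvature x hx := curvOp_vaidya hI hm hU (fun y hy => ⟨(hdom y hy).1, (hdom y hy).2.1.ne',
    (Real.sin_pos_of_pos_of_lt_pi (hdom y hy).2.2.1 (hdom y hy).2.2.2).ne'⟩) hx

/-- If `m'` does not vanish at a point, then a small change of `u` leads to a point where neither
`m` nor `m'` vanishes. -/
theorem exists_mass_ne_zero {m : ℝ → ℝ} {U : Set (Fin 4 → ℝ)} (hV : IsVaidyaDomain m U)
    (h : ∃ x ∈ U, deriv m (x 0) ≠ 0) : ∃ x ∈ U, m (x 0) ≠ 0 ∧ deriv m (x 0) ≠ 0 := by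
  obtain ⟨x, hx, hx'⟩ := h
  have h1 : ∀ᶠ u in nhdsWithin (x 0) {x 0}ᶜ, m u ≠ 0 :=
    (hV.differentiableAt x hx).hasDerivAt.eventually_ne hx'
  have h2 : ∀ᶠ u in nhdsWithin (x 0) {x 0}ᶜ, deriv m u ≠ 0 :=
    ((hV.differentiableAt_deriv x hx).continuousAt.eventually_ne hx').filter_mono
      nhdsWithin_le_nhds
  have h3 : ∀ᶠ u in nhdsWithin (x 0) {x 0}ᶜ, Function.update x 0 u ∈ U :=
    (eventually_update_mem hV.isOpen hx 0).filter_mono nhdsWithin_le_nhds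
  obtain ⟨u, hu1, hu2, hu3⟩ := (h1.and (h2.and h3)).exists
  exact ⟨Function.update x 0 u, hu3, by simpa using hu1, by simpa using hu2⟩

end Vaidya

end

theorem theorem4p1 (m : ℝ → ℝ) (I : Set ℝ) (hI : IsOpen I) (hm : ContDiffOn ℝ ∞ m I)
    (U : Set (Fin 4 → ℝ)) (hU : IsOpen U)
    (hdom : ∀ x ∈ U, x 0 ∈ I ∧ 0 < x 1 ∧ 0 < x 2 ∧ x 2 < Real.pi)
    (hm' : ∃ x ∈ U, deriv m (x 0) ≠ 0) :
    let g := Vaidya.vaidya m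
    let R := Vaidya.riemann g
    let S := Vaidya.ricci g
    let C := Vaidya.weyl g
    let K := Vaidya.conharmonic g
    let P := Vaidya.projective g
    let W := Vaidya.concircular g
    let gT := Vaidya.metric g
    -- Ricci tensor and scalar curvature
    (¬ (∀ x ∈ U, S x = 0) ∧
      ¬ (∀ x ∈ U, ∀ a, Vaidya.covDeriv g S x a = 0) ∧
      ∀ x ∈ U, Vaidya.scalarCurv g x = 0 ∧ R x = W x ∧ C x = K x) ∧
    -- semisymmetry and pseudosymmetry
    (¬ (∀ x ∈ U, Vaidya.dot (g x) (R x) (C x) = 0) ∧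
      ¬ Vaidya.DeszczPseudosymmetric g U ∧
      ∀ x ∈ U, Vaidya.dot (g x) (C x) (C x) =
        (m (x 0) / x 1 ^ 3) • Vaidya.tachibana (gT x) (C x)) ∧
    -- generalized pseudosymmetric type conditions
    (¬ Vaidya.RicciGeneralizedPseudosymmetric g U ∧
      ¬ Vaidya.WeylPseudosymmetric g U ∧
      ∀ x ∈ U,
        Vaidya.dot (g x) (R x) (R x) - Vaidya.tachibana (S x) (R x) =
          (m (x 0) / x 1 ^ 3) • Vaidya.tachibana (gT x) (C x) ∧
        Vaidya.dot (g x) (R x) (C x) + Vaidya.dot (g x) (C x) (R x) =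
          (2 * m (x 0) / x 1 ^ 3) • Vaidya.tachibana (gT x) (C x)
            + Vaidya.tachibana (S x) (C x)) ∧
    -- recurrence
    (¬ (∃ Pi, Vaidya.RecurrentWith g U C Pi) ∧
      ¬ (∃ Pi, Vaidya.OneFormsRecurrentWith g U S Pi) ∧
      ((∀ x ∈ U, m (x 0) ≠ 0) →
        ¬ Vaidya.CurvFormsRecurrent g U R ∧
        Vaidya.CurvFormsRecurrent g U C ∧
        Vaidya.CurvFormsRecurrentWith g U C (fun x => ![deriv m (x 0) / m (x 0), 0, 0, 0]))) ∧
    -- Ricci simple, not Einstein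
    (¬ (∃ α : (Fin 4 → ℝ) → ℝ, ∀ x ∈ U, S x = α x • gT x) ∧
      ∀ x ∈ U,
        (∀ i j, S x ![i, j] = 2 * deriv m (x 0) * (Vaidya.eta x i * Vaidya.eta x j)) ∧
        Vaidya.covectorSq g x (Vaidya.eta x) = 0 ∧
        Vaidya.kulkarniNomizu (S x) (S x) = 0 ∧
        Vaidya.ricciSq g x = 0) ∧
    -- derivatives and compatibility of the Ricci tensor
    (¬ Vaidya.IsCyclicParallel g U S ∧
      ¬ Vaidya.IsCodazzi g U S ∧
      ∀ x ∈ U, Vaidya.IsCompatible (g x) (R x) (S x) ∧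
        Vaidya.IsCompatible (g x) (C x) (S x)) ∧
    -- compatible tensors of the Riemann and the projective tensor
    (∀ x ∈ U, m (x 0) ≠ 0 → ∀ A : Matrix (Fin 4) (Fin 4) ℝ,
      (Vaidya.IsCompatible (g x) (R x) (Vaidya.ofMatrix A) ↔
        ∃ a₁₁ a₁₂ a₂₂ a₃₃ a₄₃ a₄₄ : ℝ,
          A = !![a₁₁, a₁₂, 0, 0;
                 a₁₂ + x 1 * deriv m (x 0) / m (x 0) * a₂₂, a₂₂, 0, 0;
                 0, 0, a₃₃, a₄₃;
                 0, 0, a₄₃, a₄₄]) ∧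
      (Vaidya.IsCompatibleLast (g x) (P x) (Vaidya.ofMatrix A) ↔
        ∃ a₁₁ a₁₂ a₂₂ a₃₃ a₄₃ a₄₄ : ℝ,
          A = !![a₁₁, a₁₂, 0, 0;
                 a₁₂ + x 1 * deriv m (x 0) / m (x 0) * a₂₂, a₂₂, 0, 0;
                 0, 0, a₃₃, a₄₃;
                 0, 0, a₄₃, a₄₄]) ∧
      (A.IsSymm →
        ((Vaidya.IsCompatible (g x) (R x) (Vaidya.ofMatrix A) ↔
          ∃ a₁₁ a₁₂ a₂₂ a₃₃ a₄₃ a₄₄ : ℝ, deriv m (x 0) * a₂₂ = 0 ∧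
            A = !![a₁₁, a₁₂, 0, 0;
                   a₁₂, a₂₂, 0, 0;
                   0, 0, a₃₃, a₄₃;
                   0, 0, a₄₃, a₄₄]) ∧
        (Vaidya.IsCompatibleLast (g x) (P x) (Vaidya.ofMatrix A) ↔
          ∃ a₁₁ a₁₂ a₂₂ a₃₃ a₄₃ a₄₄ : ℝ, deriv m (x 0) * a₂₂ = 0 ∧
            A = !![a₁₁, a₁₂, 0, 0;
                   a₁₂, a₂₂, 0, 0;
                   0, 0, a₃₃, a₄₃;
                   0, 0, a₄₃, a₄₄])))) ∧
    -- compatible tensors of the conformal and the conharmonic tensor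
    (∀ x ∈ U, m (x 0) ≠ 0 → ∀ A : Matrix (Fin 4) (Fin 4) ℝ,
      (Vaidya.IsCompatible (g x) (C x) (Vaidya.ofMatrix A) ↔
        ∃ a₁₁ a₁₂ a₂₂ a₃₃ a₃₄ a₄₄ : ℝ,
          A = !![a₁₁, a₁₂, 0, 0;
                 a₁₂, a₂₂, 0, 0;
                 0, 0, a₃₃, a₃₄;
                 0, 0, a₃₄, a₄₄]) ∧
      (Vaidya.IsCompatible (g x) (K x) (Vaidya.ofMatrix A) ↔
        ∃ a₁₁ a₁₂ a₂₂ a₃₃ a₃₄ a₄₄ : ℝ,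
          A = !![a₁₁, a₁₂, 0, 0;
                 a₁₂, a₂₂, 0, 0;
                 0, 0, a₃₃, a₃₄;
                 0, 0, a₃₄, a₄₄])) := by 
  have hV := Vaidya.isVaidyaDomain hI hm hU hdom
  obtain ⟨z, hz, hz', hzd⟩ := Vaidya.exists_mass_ne_zero hV hm'
  have hzc := hV.curvature z hz
  have hzr := hV.r_ne_zero z hz
  have hzs := hV.sin_ne_zero z hz
  have hSz : Vaidya.ricci (Vaidya.vaidya m) z ![0, 0] ≠ 0 := by
    simp [Vaidya.ricci_vaidya hzc, Vaidya.du, hzd, hzr]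
  have hDS : -(2 * deriv m (z 0) / z 1) ≠ 0 := by simp [hzd, hzr]
  intro g R S C K P W gT
  refine ⟨⟨fun h => ?_, fun h => ?_, fun x hx => ?_⟩, ⟨fun h => ?_, ?_, fun x hx => ?_⟩,
    ⟨?_, ?_, fun x hx => ⟨?_, ?_⟩⟩, ⟨?_, ?_, fun h0 => ?_⟩,
    ⟨?_, fun x hx => ⟨fun i j => ?_, ?_, ?_, ?_⟩⟩,
    ⟨fun h => ?_, fun h => ?_, fun x hx => ?_⟩, fun x hx hx0 A => ?_, fun x hx hx0 A => ?_⟩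
  · exact hSz (congrFun (h z hz) _)
  · exact hDS ((Vaidya.covDeriv_ricci_θ_θu hV hz).symm.trans (congrFun (h z hz 2) ![2, 0]))
  · have hc := hV.curvature x hx
    have hr := hV.r_ne_zero x hx
    have hs := hV.sin_ne_zero x hx
    exact ⟨Vaidya.scalarCurv_vaidya hc hr hs, (Vaidya.concircular_vaidya hc hr hs).symm,
      (Vaidya.weyl_vaidya hc hr hs).trans (Vaidya.conharmonic_vaidya hc).symm⟩
  · exact Vaidya.dot_riemann_weyl_ne_zero hzc hzr hzs hz' (h z hz)
  · exact Vaidya.not_deszczPseudosymmetric hz hzc hzr hzs hz' hzd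
  · exact Vaidya.dot_weyl_weyl (hV.curvature x hx) (hV.r_ne_zero x hx) (hV.sin_ne_zero x hx)
  · exact Vaidya.not_ricciGeneralizedPseudosymmetric hz hzc hzr hzs hz' hzd
  · exact Vaidya.not_weylPseudosymmetric hz hzc hzr hzs hz' hzd
  · exact Vaidya.dot_riemann_riemann_sub (hV.curvature x hx) (hV.r_ne_zero x hx)
      (hV.sin_ne_zero x hx)
  · exact Vaidya.dot_riemann_weyl_add (hV.curvature x hx) (hV.r_ne_zero x hx)
      (hV.sin_ne_zero x hx)
  · rintro ⟨Pi, h⟩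
    exact Vaidya.not_recurrentWith_weyl hV hz hz' Pi h
  · rintro ⟨Pi, h⟩
    exact Vaidya.not_oneFormsRecurrentWith hV hz hzd Pi h
  · have h := Vaidya.curvFormsRecurrentWith_weyl hV h0
    refine ⟨Vaidya.not_curvFormsRecurrent_riemann hV h0, ⟨_, ⟨z, hz, fun e => ?_⟩, h⟩, h⟩
    exact div_ne_zero hzd hz' (congrFun e 0)
  · rintro ⟨α, h⟩
    -- the component `g(∂_u, ∂_r) = -1` forces `α = 0`
    have h1 := congrFun (h z hz) ![0, 1]
    have h2 := congrFun (h z hz) ![0, 0]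
    simp [S, g, gT, Vaidya.ricci_vaidya hzc, Vaidya.du, Vaidya.metric, Vaidya.vaidya] at h1
    exact hSz (by simpa [h1] using h2)
  · have hr := hV.r_ne_zero x hx
    simp only [S, g, Vaidya.ricci_vaidya (hV.curvature x hx), Pi.smul_apply, Vaidya.symProd_apply,
      smul_eq_mul]
    fin_cases i <;> fin_cases j <;> simp [Vaidya.du, Vaidya.eta]
    field_simp
    ring
  · simp [Vaidya.covectorSq, g, Vaidya.vaidya_inv m (hV.r_ne_zero x hx) (hV.sin_ne_zero x hx),
      Fin.sum_univ_four, Vaidya.inverseMetric, Vaidya.eta]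
  · simp only [S, g, Vaidya.ricci_vaidya (hV.curvature x hx), Vaidya.smul_kulkarniNomizu,
      Vaidya.kulkarniNomizu_smul, Vaidya.kulkarniNomizu_symProd_self, smul_zero]
  · ext J
    simp [Vaidya.ricciSq, Vaidya.endo, g, Vaidya.ricci_vaidya (hV.curvature x hx),
      Vaidya.vaidya_inv m (hV.r_ne_zero x hx) (hV.sin_ne_zero x hx), Fin.sum_univ_four,
      Vaidya.inverseMetric, Vaidya.du]
  · have e := h z hz 2 2 0
    rw [Vaidya.covDeriv_ricci_θ_θu hV hz, Vaidya.covDeriv_ricci_θ_uθ hV hz,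
      Vaidya.covDeriv_ricci_u_θθ hV hz] at e
    exact hDS (by linarith)
  · have e := h z hz 0 2 2
    rw [Vaidya.covDeriv_ricci_θ_uθ hV hz, Vaidya.covDeriv_ricci_u_θθ hV hz] at e
    exact hDS e.symm
  · exact Vaidya.isCompatible_ricci (hV.curvature x hx) (hV.r_ne_zero x hx) (hV.sin_ne_zero x hx)
  · have hc := hV.curvature x hx
    have hr := hV.r_ne_zero x hx
    have hs := hV.sin_ne_zero x hx
    have hform : A = !![A 0 0, A 0 1, 0, 0;
          A 0 1 + x 1 * deriv m (x 0) / m (x 0) * A 1 1, A 1 1, 0, 0;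
          0, 0, A 2 2, A 3 2; 0, 0, A 3 2, A 3 3] ↔
        ∃ a₁₁ a₁₂ a₂₂ a₃₃ a₄₃ a₄₄ : ℝ,
          A = !![a₁₁, a₁₂, 0, 0; a₁₂ + x 1 * deriv m (x 0) / m (x 0) * a₂₂, a₂₂, 0, 0;
                 0, 0, a₃₃, a₄₃; 0, 0, a₄₃, a₄₄] :=
      ⟨fun h => ⟨_, _, _, _, _, _, h⟩, by rintro ⟨a₁₁, a₁₂, a₂₂, a₃₃, a₄₃, a₄₄, rfl⟩; simp⟩
    have hsymm : A.IsSymm → ((∃ a₁₁ a₁₂ a₂₂ a₃₃ a₄₃ a₄₄ : ℝ,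
          A = !![a₁₁, a₁₂, 0, 0; a₁₂ + x 1 * deriv m (x 0) / m (x 0) * a₂₂, a₂₂, 0, 0;
                 0, 0, a₃₃, a₄₃; 0, 0, a₄₃, a₄₄]) ↔
        ∃ a₁₁ a₁₂ a₂₂ a₃₃ a₄₃ a₄₄ : ℝ, deriv m (x 0) * a₂₂ = 0 ∧
          A = !![a₁₁, a₁₂, 0, 0; a₁₂, a₂₂, 0, 0; 0, 0, a₃₃, a₄₃; 0, 0, a₄₃, a₄₄]) := by
      intro hA
      have hz : ∀ b, x 1 * deriv m (x 0) / m (x 0) * b = 0 ↔ deriv m (x 0) * b = 0 := fun b => by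
        simp [hr, hx0]
      constructor
      · rintro ⟨a₁₁, a₁₂, a₂₂, a₃₃, a₄₃, a₄₄, rfl⟩
        have h01 := hA.apply 1 0
        simp only [Matrix.of_apply, Matrix.cons_val] at h01
        have h0 : x 1 * deriv m (x 0) / m (x 0) * a₂₂ = 0 := by linarith
        exact ⟨a₁₁, a₁₂, a₂₂, a₃₃, a₄₃, a₄₄, (hz _).1 h0, by rw [h0, add_zero]⟩
      · rintro ⟨a₁₁, a₁₂, a₂₂, a₃₃, a₄₃, a₄₄, h0, rfl⟩
        exact ⟨a₁₁, a₁₂, a₂₂, a₃₃, a₄₃, a₄₄, by rw [(hz _).2 h0, add_zero]⟩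
    have hR := (Vaidya.isCompatible_riemann_iff hc hr hs hx0 A).trans hform
    have hP := (Vaidya.isCompatibleLast_projective_iff hc hr hs hx0 A).trans hform
    exact ⟨hR, hP, fun hA => ⟨hR.trans (hsymm hA), hP.trans (hsymm hA)⟩⟩
  · have hc := hV.curvature x hx
    have hr := hV.r_ne_zero x hx
    have hs := hV.sin_ne_zero x hx
    have hform : A = !![A 0 0, A 0 1, 0, 0; A 0 1, A 1 1, 0, 0;
          0, 0, A 2 2, A 3 2; 0, 0, A 3 2, A 3 3] ↔
        ∃ a₁₁ a₁₂ a₂₂ a₃₃ a₃₄ a₄₄ : ℝ,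
          A = !![a₁₁, a₁₂, 0, 0; a₁₂, a₂₂, 0, 0; 0, 0, a₃₃, a₃₄; 0, 0, a₃₄, a₄₄] :=
      ⟨fun h => ⟨_, _, _, _, _, _, h⟩, by rintro ⟨a₁₁, a₁₂, a₂₂, a₃₃, a₄₃, a₄₄, rfl⟩; simp⟩
    have hC := (Vaidya.isCompatible_weyl_iff hc hr hs hx0 A).trans hform
    have hK : K x = C x := (Vaidya.conharmonic_vaidya hc).trans (Vaidya.weyl_vaidya hc hr hs).symm
    exact ⟨hC, by rw [hK]; exact hC⟩
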